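/- Notation. Let $\mathcal M^+(X)$ be the set of nonzero finite Borel measures on $X$. For $s_1,s_2>0$ and probability measures $\mu_1,\mu_2$ put $W_1(s_1\mu_1,s_2\mu_2)=W_1(\mu_1,\mu_2)+|s_1-s_2|$, where $W_1(\mu_1,\mu_2)=\inf_\pi\int|x-y|\,d\pi(x,y)$, over all couplings $\pi$, is the usual 1-Wasserstein distance (possibly $+\infty$). Let $C^1_0(\mathbb R^{n})$ be the space of compactly supported $C^1$ functions. Fix a compact $\Omega\subset\mathbb R^d$ and $\eta>0$. For a set $S\subset(0,\infty)$ let $\mathcal M^+_S=\{\mu\in\mathcal M^+(\Omega):\mu(\Omega)\in S\}$, and let $\mathcal X_S$ be the set of triplets $(\mu,x,\psi)$ with $\mu\in\mathcal M^+_S$, $x\in\Omega$ and $\psi\in C^1_0(\mathbb R^{d'})$, $\mathrm{Lip}(\psi)\le\eta$, with the distance $$D_{\mathcal X}\big((\mu_1,x_1,\psi_1),(\mu_2,x_2,\psi_2)\big)=W_1(\mu_1,\mu_2)+|x_1-x_2|+\|\psi_1-\psi_2\|_{L^\infty}.$$ Pairs $(\mu,x)\in\mathcal M^+(\Omega)\times\Omega$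 carry the distance $W_1(\mu_1,\mu_2)+|x_1-x_2|$. Let $f:\mathcal M^+(\Omega)\to\mathcal M^+(\mathbb R^{d'})$. - $f$ is *support-preserving* if for all $n\ge1$, $c>0$ and $x_1,\dots,x_n\in\Omega$ there are $y_1,\dots,y_n\in\mathbb R^{d'}$ with $f\big(\sum_i\frac cn\delta_{x_i}\big)=\sum_i\frac cn\delta_{y_i}$ and $y_i=y_j$ whenever $x_i=x_j$. - For $G:\mathcal M^+(\Omega)\times\Omega\to\mathbb R^{d'}$, $f=f_G$ means that $f(\mu)=G(\mu,\cdot)_\#\mu$ for all $\mu\in\mathcal M^+(\Omega)$. - The *$L^\infty$-regular part of the Fréchet derivative* of $f$ exists at $(\mu,x,\psi)$ and equals $L=\overline{\mathcal D}_f(\mu,x,\psi)$ if $$\lim_{k\to\infty}\lim_{\epsilon\to+0}\frac{\int\psi_k\,df(\mu_k+\epsilon\delta_x)-\int\psi_k\,df(\mu_k)}{\epsilon}=L$$ (all these limits existing) for all $\mu_k\in\mathcal M^+(\Omega)$ and $\psi_k\in C^1_0(\mathbb R^{d'})$ such that $\psi_k$ is locally constant on an open neighborhood of $\mathrm{supp}\,f(\mu_k)$,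 $W_1(\mu_k,\mu)\to0$ and $\|\psi_k-\psi\|_{L^\infty}\to0$. **Theorem.** Let $\Omega\subset\mathbb R^d$ be compact, let $f:\mathcal M^+(\Omega)\to\mathcal M^+(\mathbb R^{d'})$ be continuous with respect to $W_1$, and let $\eta>0$. 1. There is a continuous $G:\mathcal M^+(\Omega)\times\Omega\to\mathbb R^{d'}$ with $f=f_G$ if and only if $f$ is support-preserving, $\overline{\mathcal D}_f(\mu,x,\psi)$ exists for all $(\mu,x,\psi)\in\mathcal X_{(0,\infty)}$, and $\overline{\mathcal D}_f$ is uniformly continuous on $\mathcal X_{[\delta,\rho]}$ for $D_{\mathcal X}$, for all $0<\delta\le\rho$. 2. There is a $G:\mathcal M^+(\Omega)\times\Omega\to\mathbb R^{d'}$ with $f=f_G$ that is uniformly continuous on $\mathcal M^+_{(0,\rho]}\times\Omega$ for every $\rho>0$ if and only if $f$ is support-preserving, $\overline{\mathcal D}_f(\mu,x,\psi)$ exists for all $(\mu,x,\psi)\in\mathcal X_{(0,\infty)}$, and $\overline{\mathcal D}_f$ is uniformly continuous on $\mathcal X_{(0,\rho]}$ for $D_{\mathcal X}$, for every $\rho>0$.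 3. Moreover, if $f=f_G$ with $G$ continuous, then, for every $\rho>0$, $G$ is Lipschitz on $\mathcal M^+_{(0,\rho]}\times\Omega$ if and only if $\overline{\mathcal D}_f$ is Lipschitz on $\mathcal X_{(0,\rho]}$ for $D_{\mathcal X}$; and $G$ is Lipschitz on $\mathcal M^+(\Omega)\times\Omega$ if and only if $\overline{\mathcal D}_f$ is Lipschitz on $\mathcal X_{(0,\infty)}$. -/

import Mathlib

open MeasureTheory Filter Topology
open scoped NNReal ENNReal

noncomputable section

namespace InContext

/-- The Euclidean space of dimension `n`. -/
abbrev E (n : ℕ) : Type := EuclideanSpace ℝ (Fin n)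

/-- The nonzero finite measures on `X` (strictly positive total mass). -/
abbrev PosMeasure (X : Type*) [MeasurableSpace X] : Type _ := {μ : FiniteMeasure X // μ ≠ 0}

namespace PosMeasure

variable {X : Type*} [MeasurableSpace X]

/-- The underlying measure. -/
def toMeas (μ : PosMeasure X) : Measure X := (μ.1 : Measure X)

/-- The total mass. -/
def mass (μ : PosMeasure X) : ℝ≥0 := μ.1.mass

/-- The probability measure obtained by dividing by the total mass. -/
def normalized (μ : PosMeasure X) : Measure X := (μ.mass)⁻¹ • μ.toMeas

/-- The measure `μ + ε δ_x`. -/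
def addDirac (μ : PosMeasure X) (ε : ℝ≥0) (x : X) : PosMeasure X :=
  ⟨⟨μ.toMeas + ε • Measure.dirac x, by unfold toMeas; infer_instance⟩, by
    intro h
    apply μ.2
    have h1 : μ.toMeas + ε • Measure.dirac x = 0 := congrArg Subtype.val h
    apply Subtype.ext
    have h2 : μ.toMeas ≤ 0 := h1 ▸ Measure.le_add_right le_rfl
    exact le_antisymm h2 (Measure.zero_le _)⟩

end PosMeasure

/-- The 1-Wasserstein distance of two probability measures: the infimum of the transport cost
`∫ |x - y| dπ(x, y)` over all couplings `π`. -/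
def wassersteinProb {X : Type*} [MeasurableSpace X] [PseudoEMetricSpace X]
    (μ ν : Measure X) : ℝ≥0∞ :=
  ⨅ (π : Measure (X × X)) (_ : π.map Prod.fst = μ) (_ : π.map Prod.snd = ν),
    ∫⁻ p, edist p.1 p.2 ∂π

/-- The extended 1-Wasserstein distance of two nonzero finite measures:
`W₁(s₁ μ₁, s₂ μ₂) = W₁(μ₁, μ₂) + |s₁ - s₂|` for probability measures `μ₁, μ₂`. -/
def W1 {X : Type*} [MeasurableSpace X] [PseudoEMetricSpace X] (μ ν : PosMeasure X) : ℝ≥0∞ :=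
  wassersteinProb μ.normalized ν.normalized + edist μ.mass ν.mass

/-- Continuity with respect to given distance functions. -/
def ContinuousWrt {A B : Type*} (dA : A → A → ℝ≥0∞) (dB : B → B → ℝ≥0∞) (g : A → B) : Prop :=
  ∀ a, ∀ ε : ℝ≥0∞, 0 < ε → ∃ δ : ℝ≥0∞, 0 < δ ∧ ∀ a', dA a' a < δ → dB (g a') (g a) < ε

/-- Uniform continuity on a set with respect to given distance functions. -/
def UniformContinuousOnWrt {A B : Type*} (dA : A → A → ℝ≥0∞) (dB : B → B → ℝ≥0∞)
    (g : A → B) (S : Set A) : Prop :=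
  ∀ ε : ℝ≥0∞, 0 < ε → ∃ δ : ℝ≥0∞, 0 < δ ∧
    ∀ a ∈ S, ∀ a' ∈ S, dA a a' < δ → dB (g a) (g a') < ε

/-- Lipschitz continuity (with some constant) on a set with respect to given distance
functions. -/
def LipschitzOnWrt {A B : Type*} (dA : A → A → ℝ≥0∞) (dB : B → B → ℝ≥0∞)
    (g : A → B) (S : Set A) : Prop :=
  ∃ C : ℝ≥0, ∀ a ∈ S, ∀ a' ∈ S, dB (g a) (g a') ≤ C * dA a a'

variable {d d' : ℕ}

/-- The space `C¹₀(ℝⁿ)` of continuously differentiable, compactly supported functions. -/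
abbrev TestFun (n : ℕ) : Type := {ψ : E n → ℝ // ContDiff ℝ 1 ψ ∧ HasCompactSupport ψ}

/-- The uniform distance `‖ψ₁ - ψ₂‖_{L^∞}`. -/
def supDist {n : ℕ} (ψ₁ ψ₂ : TestFun n) : ℝ≥0∞ := ⨆ y, edist (ψ₁.1 y) (ψ₂.1 y)

/-- The sum distance on pairs `(μ, x)`. -/
def pairDist {Ω : Set (E d)} (p q : PosMeasure Ω × Ω) : ℝ≥0∞ :=
  W1 p.1 q.1 + edist p.2 q.2

/-- The distance `D_𝒳` on triplets `(μ, x, ψ)`. -/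
def tripletDist {Ω : Set (E d)} (p q : PosMeasure Ω × Ω × TestFun d') : ℝ≥0∞ :=
  W1 p.1 q.1 + edist p.2.1 q.2.1 + supDist p.2.2 q.2.2

/-- The pairs `(μ, x)` for which the total mass of `μ` lies in `S`. -/
def pairSpace (Ω : Set (E d)) (S : Set ℝ≥0) : Set (PosMeasure Ω × Ω) :=
  {p | p.1.mass ∈ S}

/-- The triplets `(μ, x, ψ)` for which the total mass of `μ` lies in `S` and `Lip(ψ) ≤ η`. For
`S = [0, ρ]` this is the space `𝒳_{Ω, ρ, η}`. -/
def tripletSpace (Ω : Set (E d)) (d' : ℕ) (S : Set ℝ≥0) (η : ℝ≥0) :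
    Set (PosMeasure Ω × Ω × TestFun d') :=
  {p | p.1.mass ∈ S ∧ LipschitzWith η p.2.2.1}

/-- Support-preserving maps: for every `n`, all points `x₁, …, xₙ` and every `c > 0`, the measure
`∑ (c / n) δ_{xᵢ}` is mapped to some `∑ (c / n) δ_{yᵢ}` such that `xᵢ = xⱼ` implies `yᵢ = yⱼ`. -/
def SupportPreserving {Ω : Set (E d)} (f : PosMeasure Ω → PosMeasure (E d')) : Prop :=
  ∀ (n : ℕ) (c : ℝ≥0) (x : Fin n → Ω) (μ : PosMeasure Ω), 0 < c →
    μ.toMeas = ∑ i, (c / n : ℝ≥0) • Measure.dirac (x i) →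
    ∃ y : Fin n → E d',
      (f μ).toMeas = ∑ i, (c / n : ℝ≥0) • Measure.dirac (y i) ∧
      ∀ i j, x i = x j → y i = y j

/-- `f = f_G`, that is, `f(μ) = G(μ)_# μ` for all `μ`. -/
def IsGivenBy {Ω : Set (E d)} (f : PosMeasure Ω → PosMeasure (E d'))
    (G : PosMeasure Ω × Ω → E d') : Prop :=
  ∀ μ, Measurable (fun x => G (μ, x)) ∧ (f μ).toMeas = μ.toMeas.map (fun x => G (μ, x))

/-- `ψ` is locally constant on an open neighborhood of the support of `ν`. -/
def LocallyConstantNearSupport {n : ℕ} (ψ : TestFun n) (ν : PosMeasure (E n)) : Prop :=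
  ∃ U : Set (E n), IsOpen U ∧ ν.toMeas.support ⊆ U ∧ ∀ y ∈ U, ∀ᶠ z in 𝓝 y, ψ.1 z = ψ.1 y

/-- The difference quotient `⟨ψ, f(μ + ε δ_x) - f(μ)⟩ / ε`. -/
def diffQuotient {Ω : Set (E d)} (f : PosMeasure Ω → PosMeasure (E d'))
    (μ : PosMeasure Ω) (x : Ω) (ψ : TestFun d') (ε : ℝ≥0) : ℝ :=
  ((∫ y, ψ.1 y ∂(f (μ.addDirac ε x)).toMeas) - ∫ y, ψ.1 y ∂(f μ).toMeas) / (ε : ℝ)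

/-- The `L^∞`-regular part of the Fréchet derivative of `f` at `p = (μ, x, ψ)` exists and equals
`L`: for all sequences `μ_k → μ` in the 1-Wasserstein distance and `ψ_k → ψ` uniformly such that
`ψ_k` is locally constant near the support of `f(μ_k)`, the iterated limit
`lim_k lim_{ε → 0+} ⟨ψ_k, f(μ_k + ε δ_x) - f(μ_k)⟩ / ε` exists and equals `L`. -/
def HasRegularPart {Ω : Set (E d)} (f : PosMeasure Ω → PosMeasure (E d'))
    (p : PosMeasure Ω × Ω × TestFun d') (L : ℝ) : Prop :=
  ∀ (μk : ℕ → PosMeasure Ω) (ψk : ℕ → TestFun d'),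
    (∀ k, LocallyConstantNearSupport (ψk k) (f (μk k))) →
    Tendsto (fun k => W1 (μk k) p.1) atTop (𝓝 0) →
    Tendsto (fun k => supDist (ψk k) p.2.2) atTop (𝓝 0) →
    ∃ Lk : ℕ → ℝ,
      (∀ k, Tendsto (fun ε : ℝ≥0 => diffQuotient f (μk k) p.2.1 (ψk k) ε)
        (𝓝[>] 0) (𝓝 (Lk k))) ∧
      Tendsto Lk atTop (𝓝 L)

/-- `D` is the function `(μ, x, ψ) ↦ 𝒟_f(μ, x, ψ)`, which exists at all triplets with
`Lip(ψ) ≤ η` (and with arbitrary total mass of `μ`). -/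
def IsRegularPart {Ω : Set (E d)} (f : PosMeasure Ω → PosMeasure (E d')) (η : ℝ≥0)
    (D : PosMeasure Ω × Ω × TestFun d' → ℝ) : Prop :=
  ∀ p ∈ tripletSpace Ω d' Set.univ η, HasRegularPart f p (D p)

end InContext

end

/-!
*From the in-context map to the derivative.* If `f(μ) = G(μ, ·)_# μ` with `G` continuous, then for
small `ε` the points `G (μ + ε δ_x, y)`, `y ∈ supp μ`, stay in the region where an admissible test
function `ψ` is locally constant, so the difference quotient equals `ψ (G (μ + ε δ_x, x))`. Hence
the regular part of the derivative is `D (μ, x, ψ) = ψ (G (μ, x))`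
(`IsGivenBy.tendsto_diffQuotient`, `IsGivenBy.hasRegularPart`). It is unique
(`HasRegularPart.unique`) because there are finitely supported measures near every measure, and near
the image of such a measure every test function is a uniform limit of admissible ones.

*Equivalence of the moduli of continuity.* Once `D (μ, x, ψ) = ψ (G (μ, x))` is known, `G` and `D`
have the same regularity on every range of total masses: `ψ` is `η`-Lipschitz, and conversely a
rescaled bump function that is `η`-Lipschitz detects a fixed fraction of `|a - b|`
for any two points (`uniformContinuousOnWrt_iff`, `lipschitzOnWrt_iff`).

*From the derivative to the in-context map.* Call `μ = ∑ w j δ_{x j}` dissociated if the weights are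
commensurable and different sets of indices have different total weights. Support preservation
gives `f(μ) = ∑ w j δ_{y j}`, and dissociation makes the labelling of the `y j` unambiguous. If a
little mass is added at `x i`, the atoms of the image converge to the `y j` with the same labels,
whence `D (μ, x i, ψ) = ψ (y i)` (`IsDissociated.exists_regularPart`). Dissociated measures with a
prescribed atom are dense (`mem_closure_isDissociated`), and `D` is continuous uniformly in `ψ`, so
`D (μ, x, ·)` is the evaluation at some point `G (μ, x)` for every pair (`exists_eval_eq`). The
identity `f(μ) = G(μ, ·)_# μ` holds for dissociated `μ` and passes to limits
(`isGivenBy_of_eval_eq`).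

*Topology.* Convergence in `W1` implies weak convergence, and the converse holds on a compact space
(`tendsto_wassersteinProb_nhds`). So on `Ω` all the notions of continuity are topological, and the
measures with total mass in `[δ, ρ]`, `δ > 0`, form a compact set, on which a continuous `G` is
uniformly continuous (`uniformContinuousOnWrt_of_continuous`).
-/

namespace InContext

/-! ### The 1-Wasserstein distance and weak convergence -/

section Wasserstein

variable {X : Type*} [MeasurableSpace X]

/-- The easy half of Kantorovich duality. -/
theorem edist_integral_le_of_wassersteinProb_lt [PseudoMetricSpace X] [OpensMeasurableSpace X]
    {P Q : Measure X} [IsProbabilityMeasure P] [IsProbabilityMeasure Q]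
    {φ : X → ℝ} {K : ℝ≥0} (hφ : LipschitzWith K φ) {C : ℝ} (hC : ∀ x, |φ x| ≤ C)
    {θ : ℝ≥0∞} (hθ : wassersteinProb P Q < θ) :
    edist (∫ x, φ x ∂P) (∫ x, φ x ∂Q) ≤ K * θ := by
  unfold wassersteinProb at hθ
  simp only [iInf_lt_iff] at hθ
  obtain ⟨π, h1, h2, hπ⟩ := hθ
  have hP : IsProbabilityMeasure π := by
    constructor
    have := measure_univ (μ := P)
    rwa [← h1, Measure.map_apply measurable_fst MeasurableSet.univ, Set.preimage_univ] at this
  have hm : Measurable φ := hφ.continuous.measurable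
  have i1 : Integrable (fun p : X × X => φ p.1) π :=
    Integrable.of_bound (hm.comp measurable_fst).aestronglyMeasurable C
      (Eventually.of_forall fun p => hC p.1)
  have i2 : Integrable (fun p : X × X => φ p.2) π :=
    Integrable.of_bound (hm.comp measurable_snd).aestronglyMeasurable C
      (Eventually.of_forall fun p => hC p.2)
  rw [← h1, ← h2, integral_map measurable_fst.aemeasurable hm.aestronglyMeasurable,
    integral_map measurable_snd.aemeasurable hm.aestronglyMeasurable, edist_eq_enorm_sub,
    ← integral_sub i1 i2]
  calc ‖∫ p, (φ p.1 - φ p.2) ∂π‖ₑ ≤ ∫⁻ p, ‖φ p.1 - φ p.2‖ₑ ∂π :=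
        enorm_integral_le_lintegral_enorm _
    _ ≤ ∫⁻ p, K * edist p.1 p.2 ∂π := by
        refine lintegral_mono fun p => ?_
        rw [← edist_eq_enorm_sub]
        exact hφ p.1 p.2
    _ = K * ∫⁻ p, edist p.1 p.2 ∂π := lintegral_const_mul' _ _ ENNReal.coe_ne_top
    _ ≤ K * θ := by gcongr

theorem tendsto_edist_integral_of_wassersteinProb [PseudoMetricSpace X] [OpensMeasurableSpace X]
    {ι : Type*} {l : Filter ι} {P Q : ι → ProbabilityMeasure X}
    (h : Tendsto (fun i => wassersteinProb (P i : Measure X) (Q i)) l (𝓝 0))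
    {φ : X → ℝ} {K : ℝ≥0} (hφ : LipschitzWith K φ) {C : ℝ} (hC : ∀ x, |φ x| ≤ C) :
    Tendsto (fun i => edist (∫ x, φ x ∂(P i : Measure X)) (∫ x, φ x ∂(Q i : Measure X)))
      l (𝓝 0) := by
  rw [ENNReal.tendsto_nhds_zero]
  intro ε hε
  obtain ⟨θ, hθ, hθε⟩ : ∃ θ : ℝ≥0∞, 0 < θ ∧ K * θ ≤ ε := by
    refine ⟨ε / (K + 1), ENNReal.div_pos hε.ne' (by finiteness), ?_⟩
    rw [mul_comm]
    calc ε / (K + 1) * K ≤ ε / (K + 1) * (K + 1) := by gcongr; exact le_self_add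
      _ = ε := ENNReal.div_mul_cancel (by positivity) (by finiteness)
  filter_upwards [h.eventually (gt_mem_nhds hθ)] with i hi
  exact (edist_integral_le_of_wassersteinProb_lt hφ hC hi).trans hθε

omit [MeasurableSpace X] in
theorem exists_abs_le_of_dist_le [Nonempty X] {φ : X → ℝ} {C : ℝ}
    (h : ∀ x y, dist (φ x) (φ y) ≤ C) :
    ∃ C', ∀ x, |φ x| ≤ C' := by
  obtain ⟨x₀⟩ := ‹Nonempty X›
  refine ⟨|φ x₀| + C, fun x => ?_⟩
  have h1 := h x x₀
  rw [Real.dist_eq] at h1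
  have h2 := abs_sub_abs_le_abs_sub (φ x) (φ x₀)
  linarith

theorem tendsto_of_wassersteinProb [PseudoMetricSpace X] [OpensMeasurableSpace X]
    {ι : Type*} {l : Filter ι} {P : ι → ProbabilityMeasure X} {Q : ProbabilityMeasure X}
    (h : Tendsto (fun i => wassersteinProb (P i : Measure X) Q) l (𝓝 0)) :
    Tendsto P l (𝓝 Q) := by
  -- The characterization of weak convergence by Lipschitz functions needs a countably generated
  -- filter, so it is applied to the filter of Wasserstein neighbourhoods of `Q`.
  have key : Tendsto id (comap (fun P : ProbabilityMeasure X => wassersteinProb (P : Measure X) Q)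
      (𝓝 0)) (𝓝 Q) := by
    rw [tendsto_iff_forall_lipschitz_integral_tendsto]
    rintro φ ⟨C, hC⟩ ⟨K, hK⟩
    have := Q.nonempty
    obtain ⟨C', hC'⟩ := exists_abs_le_of_dist_le hC
    rw [tendsto_iff_edist_tendsto_0]
    exact tendsto_edist_integral_of_wassersteinProb (Q := fun _ => Q) tendsto_comap hK hC'
  exact key.comp (tendsto_comap_iff.2 h)

/-- Limits along two families whose Wasserstein distance tends to `0` agree. -/
theorem eq_of_tendsto_of_wassersteinProb [PseudoMetricSpace X] [BorelSpace X]
    {ι : Type*} {l : Filter ι} [l.NeBot] {P Q : ι → ProbabilityMeasure X}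
    {P₀ Q₀ : ProbabilityMeasure X} (hP : Tendsto P l (𝓝 P₀)) (hQ : Tendsto Q l (𝓝 Q₀))
    (h : Tendsto (fun i => wassersteinProb (P i : Measure X) (Q i)) l (𝓝 0)) : P₀ = Q₀ := by
  have key : Tendsto (fun _ : ℕ => P₀) atTop (𝓝 Q₀) := by
    rw [tendsto_iff_forall_lipschitz_integral_tendsto]
    rintro φ ⟨C, hC⟩ ⟨K, hK⟩
    have := Q₀.nonempty
    obtain ⟨C', hC'⟩ := exists_abs_le_of_dist_le hC
    let φb : BoundedContinuousFunction X ℝ := ⟨⟨φ, hK.continuous⟩, ⟨C, hC⟩⟩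
    have h1 := ProbabilityMeasure.tendsto_iff_forall_integral_tendsto.1 hP φb
    have h2 := ProbabilityMeasure.tendsto_iff_forall_integral_tendsto.1 hQ φb
    have h3 := tendsto_nhds_unique (h1.edist h2)
      (tendsto_edist_integral_of_wassersteinProb h hK hC')
    have h4 : ∫ x, φ x ∂(P₀ : Measure X) = ∫ x, φ x ∂(Q₀ : Measure X) := edist_eq_zero.1 h3
    rw [h4]
    exact tendsto_const_nhds
  exact tendsto_nhds_unique tendsto_const_nhds key

/-- A transport plan between parts of `P` and `Q` is completed to a coupling by transporting the
remaining masses independently of each other. -/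
theorem wassersteinProb_le_of_partial [PseudoEMetricSpace X] {P Q : Measure X}
    [IsProbabilityMeasure P] [IsProbabilityMeasure Q] {π : Measure (X × X)} {M : ℝ≥0∞}
    (hM : ∀ x y : X, edist x y ≤ M)
    (h1 : π.map Prod.fst ≤ P) (h2 : π.map Prod.snd ≤ Q) :
    wassersteinProb P Q ≤ (∫⁻ p, edist p.1 p.2 ∂π) + M * (1 - π Set.univ) := by
  have u1 : (π.map Prod.fst) Set.univ = π Set.univ := by
    rw [Measure.map_apply measurable_fst MeasurableSet.univ, Set.preimage_univ]
  have u2 : (π.map Prod.snd) Set.univ = π Set.univ := by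
    rw [Measure.map_apply measurable_snd MeasurableSet.univ, Set.preimage_univ]
  have f1 : IsFiniteMeasure (π.map Prod.fst) := ⟨(h1 _).trans_lt (measure_lt_top P _)⟩
  have f2 : IsFiniteMeasure (π.map Prod.snd) := ⟨(h2 _).trans_lt (measure_lt_top Q _)⟩
  set A := P - π.map Prod.fst with hA
  set B := Q - π.map Prod.snd with hB
  have eA : A + π.map Prod.fst = P := Measure.sub_add_cancel_of_le h1
  have eB : B + π.map Prod.snd = Q := Measure.sub_add_cancel_of_le h2
  set R := 1 - π Set.univ with hR
  have mA : A Set.univ = R := by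
    rw [hA, Measure.sub_apply MeasurableSet.univ h1, u1, measure_univ]
  have mB : B Set.univ = R := by
    rw [hB, Measure.sub_apply MeasurableSet.univ h2, u2, measure_univ]
  have hRt : R ≠ ∞ := ne_top_of_le_ne_top ENNReal.one_ne_top tsub_le_self
  have fA : IsFiniteMeasure A := ⟨by rw [mA]; exact hRt.lt_top⟩
  have fB : IsFiniteMeasure B := ⟨by rw [mB]; exact hRt.lt_top⟩
  have sA : (R⁻¹ * R) • A = A := by
    by_cases h0 : R = 0
    · rw [Measure.measure_univ_eq_zero.1 (mA.trans h0), smul_zero]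
    · rw [ENNReal.inv_mul_cancel h0 hRt, one_smul]
  have sB : (R⁻¹ * R) • B = B := by
    by_cases h0 : R = 0
    · rw [Measure.measure_univ_eq_zero.1 (mB.trans h0), smul_zero]
    · rw [ENNReal.inv_mul_cancel h0 hRt, one_smul]
  unfold wassersteinProb
  refine le_trans (iInf₂_le_of_le (π + R⁻¹ • (A.prod B)) ?_ (iInf_le _ ?_)) ?_
  · rw [Measure.map_add _ _ measurable_fst, Measure.map_smul, Measure.map_fst_prod, mB, smul_smul,
      sA, add_comm, eA]
  · rw [Measure.map_add _ _ measurable_snd, Measure.map_smul, Measure.map_snd_prod, mA, smul_smul,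
      sB, add_comm, eB]
  · rw [lintegral_add_measure, lintegral_smul_measure]
    gcongr
    calc R⁻¹ • ∫⁻ p, edist p.1 p.2 ∂(A.prod B) ≤ R⁻¹ • ∫⁻ _, M ∂(A.prod B) := by
          gcongr with p; exact hM _ _
      _ = M * ((R⁻¹ * R) * R) := by
          rw [lintegral_const, ← Set.univ_prod_univ, Measure.prod_prod, mA, mB, smul_eq_mul]; ring
      _ ≤ M * (1 * R) := by gcongr; exact ENNReal.inv_mul_le_one R
      _ = M * R := by rw [one_mul]

omit [MeasurableSpace X] in
/-- A partition of unity of small mesh on a compact metric space. -/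
theorem exists_fine_partition [PseudoMetricSpace X] [CompactSpace X] {ε : ℝ} (hε : 0 < ε) :
    ∃ (s : Finset X) (φ : X → C(X, ℝ≥0)), (∀ y, ∑ x ∈ s, φ x y = 1) ∧
      ∀ x y, φ x y ≠ 0 → dist y x < ε := by
  obtain ⟨s, hs⟩ := (isCompact_univ (X := X)).elim_finite_subcover (fun x => Metric.ball x ε)
    (fun _ => Metric.isOpen_ball) (fun x _ => Set.mem_iUnion.2 ⟨x, Metric.mem_ball_self hε⟩)
  let h : X → X → ℝ≥0 := fun x y => (ε - dist y x).toNNReal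
  have hpos : ∀ y, 0 < ∑ x ∈ s, h x y := by
    intro y
    obtain ⟨x, hx⟩ := Set.mem_iUnion.1 (hs (Set.mem_univ y))
    obtain ⟨hxs, hx⟩ := Set.mem_iUnion.1 hx
    refine Finset.sum_pos' (fun _ _ => zero_le) ⟨x, hxs, ?_⟩
    simpa [h] using hx
  have hc : ∀ x, Continuous (h x) := fun x => by fun_prop
  refine ⟨s, fun x => ⟨fun y => h x y / ∑ x ∈ s, h x y,
    (hc x).div (continuous_finsetSum _ fun x _ => hc x) fun y => (hpos y).ne'⟩, ?_, ?_⟩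
  · intro y
    simp only [ContinuousMap.coe_mk]
    rw [← Finset.sum_div, div_self (hpos y).ne']
  · intro x y hxy
    by_contra hcon
    apply hxy
    have : h x y = 0 := by
      simp only [h, Real.toNNReal_eq_zero]; linarith
    simp [this]

/-- On a compact space the Wasserstein distance is continuous for the weak topology. The parts of
`P` and `Q` that are cut out by a fine partition of unity are coupled with each other. -/
theorem tendsto_wassersteinProb_nhds [PseudoMetricSpace X] [CompactSpace X]
    [SecondCountableTopology X] [BorelSpace X] (Q : ProbabilityMeasure X) :
    Tendsto (fun P : ProbabilityMeasure X => wassersteinProb (P : Measure X) Q) (𝓝 Q) (𝓝 0) := by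
  obtain ⟨M, hM⟩ : ∃ M : ℝ≥0, ∀ x y : X, edist x y ≤ M := by
    obtain ⟨C, hC⟩ := Metric.isBounded_iff.1 (isCompact_univ (X := X)).isBounded
    refine ⟨C.toNNReal, fun x y => ?_⟩
    rw [edist_dist]
    exact ENNReal.ofReal_le_ofReal (hC (Set.mem_univ x) (Set.mem_univ y))
  rw [ENNReal.tendsto_nhds_zero]
  intro ε hε
  obtain ⟨r, hr, hrε⟩ : ∃ r : ℝ≥0, 0 < r ∧ (2 * r : ℝ≥0∞) < ε := by
    obtain ⟨r, hr, h⟩ := ENNReal.lt_iff_exists_nnreal_btwn.1 hε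
    refine ⟨r / 2, half_pos (by exact_mod_cast hr), ?_⟩
    rw [← ENNReal.coe_two, ← ENNReal.coe_mul, mul_div_cancel₀ _ two_ne_zero]
    exact h
  obtain ⟨s, φ, hsum, hsupp⟩ := exists_fine_partition (X := X) (ε := r) (by exact_mod_cast hr)
  let a : X → ℝ≥0∞ := fun x => ∫⁻ y, φ x y ∂(Q : Measure X)
  let b : ProbabilityMeasure X → X → ℝ≥0∞ := fun P x => ∫⁻ y, φ x y ∂(P : Measure X)
  -- With this factor the plan `π P` below moves exactly the mass `min (a x) (b P x)` of the piece `x`;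
  -- if both masses vanish the factor is `∞`, but it then multiplies the zero measure.
  let c : ProbabilityMeasure X → X → ℝ≥0∞ := fun P x => (max (a x) (b P x))⁻¹
  have hφm : ∀ x, Measurable fun y => (φ x y : ℝ≥0∞) := fun x =>
    (φ x).continuous.measurable.coe_nnreal_ennreal
  have htot : ∀ P : ProbabilityMeasure X, ∑ x ∈ s, b P x = 1 := by
    intro P
    rw [← lintegral_finsetSum _ fun x _ => hφm x]
    have : ∀ y, ∑ x ∈ s, (φ x y : ℝ≥0∞) = 1 := fun y => by
      rw [← ENNReal.ofNNReal_finsetSum, hsum y, ENNReal.coe_one]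
    simp [this]
  have hb1 : ∀ P, ∀ x ∈ s, b P x ≠ ∞ := fun P x hx =>
    ne_top_of_le_ne_top ENNReal.one_ne_top
      ((Finset.single_le_sum (fun _ _ => zero_le) hx).trans (htot P).le)
  have hsumD : ∀ P : ProbabilityMeasure X,
      ∑ x ∈ s, (P : Measure X).withDensity (fun y => (φ x y : ℝ≥0∞)) = P := by
    intro P
    ext A hA
    rw [Measure.finsetSum_apply]
    simp_rw [withDensity_apply _ hA]
    rw [← lintegral_finsetSum _ fun x _ => hφm x]
    have : ∀ y, ∑ x ∈ s, (φ x y : ℝ≥0∞) = 1 := fun y => by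
      rw [← ENNReal.ofNNReal_finsetSum, hsum y, ENNReal.coe_one]
    simp [this]
  let π : ProbabilityMeasure X → Measure (X × X) := fun P =>
    ∑ x ∈ s, c P x • ((P : Measure X).withDensity fun y => (φ x y : ℝ≥0∞)).prod
      ((Q : Measure X).withDensity fun y => (φ x y : ℝ≥0∞))
  have hfin : ∀ (P : ProbabilityMeasure X), ∀ x ∈ s,
      IsFiniteMeasure ((P : Measure X).withDensity fun y => (φ x y : ℝ≥0∞)) := fun P x hx =>
    ⟨by rw [withDensity_apply _ MeasurableSet.univ, Measure.restrict_univ]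
        exact (hb1 P x hx).lt_top⟩
  have hmass : ∀ (P : ProbabilityMeasure X) x,
      (P : Measure X).withDensity (fun y => (φ x y : ℝ≥0∞)) Set.univ = b P x := fun P x => by
    rw [withDensity_apply _ MeasurableSet.univ, Measure.restrict_univ]
  have hπ1 : ∀ P, (π P).map Prod.fst ≤ P := by
    intro P
    rw [Measure.map_finset_sum measurable_fst.aemeasurable]
    conv_rhs => rw [← hsumD P]
    refine Finset.sum_le_sum fun x hx => ?_
    have := hfin P x hx
    have := hfin Q x hx
    rw [Measure.map_smul, Measure.map_fst_prod, smul_smul, hmass]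
    refine Measure.le_iff.2 fun A _ => ?_
    rw [Measure.smul_apply, smul_eq_mul]
    refine mul_le_of_le_one_left' ?_
    exact (mul_le_mul_right (le_max_left (a x) (b P x)) _).trans (ENNReal.inv_mul_le_one _)
  have hπ2 : ∀ P, (π P).map Prod.snd ≤ Q := by
    intro P
    rw [Measure.map_finset_sum measurable_snd.aemeasurable]
    conv_rhs => rw [← hsumD Q]
    refine Finset.sum_le_sum fun x hx => ?_
    have := hfin P x hx
    have := hfin Q x hx
    rw [Measure.map_smul, Measure.map_snd_prod, smul_smul, hmass]
    refine Measure.le_iff.2 fun A _ => ?_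
    rw [Measure.smul_apply, smul_eq_mul]
    refine mul_le_of_le_one_left' ?_
    exact (mul_le_mul_right (le_max_right (a x) (b P x)) _).trans (ENNReal.inv_mul_le_one _)
  have hπu : ∀ P, π P Set.univ = ∑ x ∈ s, min (a x) (b P x) := by
    intro P
    rw [Measure.finsetSum_apply]
    refine Finset.sum_congr rfl fun x hx => ?_
    have := hfin P x hx
    have := hfin Q x hx
    rw [Measure.smul_apply, ← Set.univ_prod_univ, Measure.prod_prod, hmass, hmass, smul_eq_mul]
    change (max (a x) (b P x))⁻¹ * (b P x * a x) = _
    rw [mul_comm (b P x), ← max_mul_min (a x), ← mul_assoc]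
    by_cases h0 : max (a x) (b P x) = 0
    · have : min (a x) (b P x) = 0 := le_antisymm (min_le_max.trans h0.le) zero_le
      rw [this, mul_zero]
    · rw [ENNReal.inv_mul_cancel h0 (by simpa using ⟨hb1 Q x hx, hb1 P x hx⟩), one_mul]
  have hcost : ∀ P, ∫⁻ p, edist p.1 p.2 ∂(π P) ≤ 2 * r := by
    intro P
    have hae : ∀ᵐ p ∂(π P), edist p.1 p.2 ≤ 2 * r := by
      have hne : ∀ (P : ProbabilityMeasure X) x,
          ∀ᵐ y ∂((P : Measure X).withDensity fun y => (φ x y : ℝ≥0∞)), φ x y ≠ 0 := by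
        intro P x
        rw [ae_withDensity_iff (hφm x)]
        exact Eventually.of_forall fun y hy => by exact_mod_cast hy
      rw [ae_finsetSum_measure_iff]
      intro x hx
      have := hfin P x hx
      have := hfin Q x hx
      refine Measure.ae_smul_measure ?_ _
      filter_upwards [Measure.quasiMeasurePreserving_fst.ae (hne P x),
        Measure.quasiMeasurePreserving_snd.ae (hne Q x)] with p h1 h2
      have hd : ∀ y, φ x y ≠ 0 → edist y x ≤ r := fun y hy => by
        rw [edist_dist, ← ENNReal.ofReal_coe_nnreal]
        exact ENNReal.ofReal_le_ofReal (hsupp x y hy).le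
      calc edist p.1 p.2 ≤ edist p.1 x + edist p.2 x := edist_triangle_right _ _ _
        _ ≤ r + r := add_le_add (hd _ h1) (hd _ h2)
        _ = 2 * r := (two_mul _).symm
    calc ∫⁻ p, edist p.1 p.2 ∂(π P) ≤ ∫⁻ _, 2 * r ∂(π P) := lintegral_mono_ae hae
      _ = 2 * r * ∑ x ∈ s, min (a x) (b P x) := by rw [lintegral_const, hπu]
      _ ≤ 2 * r * ∑ x ∈ s, b P x := by gcongr; exact min_le_right _ _
      _ = 2 * r := by rw [htot, mul_one]
  have hlim : Tendsto (fun P : ProbabilityMeasure X =>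
      2 * (r : ℝ≥0∞) + M * (1 - ∑ x ∈ s, min (a x) (b P x))) (𝓝 Q) (𝓝 (2 * r)) := by
    have hb : ∀ x, Tendsto (fun P => b P x) (𝓝 Q) (𝓝 (a x)) := fun x =>
      (ProbabilityMeasure.continuous_lintegral_continuousMap (φ x)).tendsto Q
    have h1 : Tendsto (fun P => ∑ x ∈ s, min (a x) (b P x)) (𝓝 Q) (𝓝 (∑ x ∈ s, a x)) := by
      refine tendsto_finsetSum _ fun x _ => ?_
      simpa using (tendsto_const_nhds (x := a x)).min (hb x)
    rw [htot Q] at h1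
    have h2 := ENNReal.Tendsto.sub (tendsto_const_nhds (x := (1 : ℝ≥0∞)) (f := 𝓝 Q)) h1
      (Or.inl ENNReal.one_ne_top)
    have h3 := (ENNReal.Tendsto.const_mul (a := (M : ℝ≥0∞)) h2 (Or.inr ENNReal.coe_ne_top))
    simpa using (tendsto_const_nhds (x := 2 * (r : ℝ≥0∞))).add h3
  filter_upwards [hlim.eventually (gt_mem_nhds hrε)] with P hP
  refine (wassersteinProb_le_of_partial hM (hπ1 P) (hπ2 P)).trans ?_
  rw [hπu]
  exact (add_le_add_left (hcost P) _).trans hP.le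

end Wasserstein

/-! ### The topology of the space of nonzero finite measures -/

instance {X : Type*} [MeasurableSpace X] (μ : PosMeasure X) : IsFiniteMeasure μ.toMeas :=
  inferInstanceAs (IsFiniteMeasure (μ.1 : Measure X))

namespace PosMeasure

section Topology

variable {X : Type*} [MeasurableSpace X]

theorem toMeas_ne_zero (μ : PosMeasure X) : μ.toMeas ≠ 0 := fun h =>
  μ.2 (Subtype.ext h)

theorem nonempty (μ : PosMeasure X) : Nonempty X := by
  by_contra h
  rw [not_nonempty_iff] at h
  exact μ.toMeas_ne_zero (Measure.eq_zero_of_isEmpty _)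

theorem toMeas_univ (μ : PosMeasure X) : μ.toMeas Set.univ = μ.mass :=
  FiniteMeasure.ennreal_mass.symm

theorem mass_ne_zero (μ : PosMeasure X) : μ.mass ≠ 0 := (FiniteMeasure.mass_nonzero_iff _).2 μ.2

theorem normalized_eq [Nonempty X] (μ : PosMeasure X) :
    μ.normalized = (μ.1.normalize : Measure X) :=
  (FiniteMeasure.toMeasure_normalize_eq_of_nonzero _ μ.2).symm

theorem tendsto_of_W1 [PseudoMetricSpace X] [OpensMeasurableSpace X] {ι : Type*} {l : Filter ι}
    {μ : ι → PosMeasure X} {μ₀ : PosMeasure X} (h : Tendsto (fun i => W1 (μ i) μ₀) l (𝓝 0)) :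
    Tendsto μ l (𝓝 μ₀) := by
  have := μ₀.nonempty
  rw [tendsto_subtype_rng, ← FiniteMeasure.tendsto_normalize_iff_tendsto μ₀.2]
  constructor
  · refine tendsto_of_wassersteinProb (tendsto_of_tendsto_of_tendsto_of_le_of_le
      tendsto_const_nhds h (fun _ => zero_le) fun i => ?_)
    simp only
    rw [← normalized_eq, ← normalized_eq]
    exact le_self_add
  · exact tendsto_iff_edist_tendsto_0.2 (tendsto_of_tendsto_of_tendsto_of_le_of_le
      tendsto_const_nhds h (fun _ => zero_le) fun i => le_add_self)

theorem tendsto_W1_iff [PseudoMetricSpace X] [CompactSpace X] [SecondCountableTopology X]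
    [BorelSpace X] {ι : Type*} {l : Filter ι} {μ : ι → PosMeasure X} {μ₀ : PosMeasure X} :
    Tendsto (fun i => W1 (μ i) μ₀) l (𝓝 0) ↔ Tendsto μ l (𝓝 μ₀) := by
  refine ⟨tendsto_of_W1, fun h => ?_⟩
  have := μ₀.nonempty
  rw [tendsto_subtype_rng, ← FiniteMeasure.tendsto_normalize_iff_tendsto μ₀.2] at h
  have h1 := (tendsto_wassersteinProb_nhds _).comp h.1
  have h2 := h1.add (tendsto_iff_edist_tendsto_0.1 h.2)
  rw [add_zero] at h2
  refine h2.congr fun i => ?_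
  simp only [W1, normalized_eq]
  rfl

/-- Limits along two families whose distance `W1` tends to `0` agree. -/
theorem eq_of_tendsto_of_W1 [PseudoMetricSpace X] [BorelSpace X]
    {ι : Type*} {l : Filter ι} [l.NeBot] {μ ν : ι → PosMeasure X} {μ₀ ν₀ : PosMeasure X}
    (hμ : Tendsto μ l (𝓝 μ₀)) (hν : Tendsto ν l (𝓝 ν₀))
    (h : Tendsto (fun i => W1 (μ i) (ν i)) l (𝓝 0)) : μ₀ = ν₀ := by
  have := μ₀.nonempty
  rw [tendsto_subtype_rng, ← FiniteMeasure.tendsto_normalize_iff_tendsto μ₀.2] at hμ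
  rw [tendsto_subtype_rng, ← FiniteMeasure.tendsto_normalize_iff_tendsto ν₀.2] at hν
  have h1 : μ₀.1.normalize = ν₀.1.normalize := by
    refine eq_of_tendsto_of_wassersteinProb hμ.1 hν.1
      (tendsto_of_tendsto_of_tendsto_of_le_of_le tendsto_const_nhds h (fun _ => zero_le)
        fun i => ?_)
    simp only
    rw [← normalized_eq, ← normalized_eq]
    exact le_self_add
  have h2 : μ₀.1.mass = ν₀.1.mass :=
    edist_eq_zero.1 (tendsto_nhds_unique (hμ.2.edist hν.2)
      (tendsto_of_tendsto_of_tendsto_of_le_of_le tendsto_const_nhds h (fun _ => zero_le)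
        fun i => le_add_self))
  apply Subtype.ext
  rw [μ₀.1.self_eq_mass_smul_normalize, ν₀.1.self_eq_mass_smul_normalize, h1, h2]

theorem continuous_mass [TopologicalSpace X] [OpensMeasurableSpace X] :
    Continuous (mass : PosMeasure X → ℝ≥0) :=
  FiniteMeasure.continuous_mass.comp continuous_subtype_val

theorem tendsto_integral [TopologicalSpace X] [OpensMeasurableSpace X] {ι : Type*} {l : Filter ι}
    {μ : ι → PosMeasure X} {μ₀ : PosMeasure X} (h : Tendsto μ l (𝓝 μ₀))
    (φ : BoundedContinuousFunction X ℝ) :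
    Tendsto (fun i => ∫ x, φ x ∂(μ i).toMeas) l (𝓝 (∫ x, φ x ∂μ₀.toMeas)) :=
  FiniteMeasure.tendsto_iff_forall_integral_tendsto.1 (tendsto_subtype_rng.1 h) φ

theorem tendsto_addDirac [TopologicalSpace X] [OpensMeasurableSpace X] (μ : PosMeasure X) (x : X) :
    Tendsto (fun ε => μ.addDirac ε x) (𝓝 0) (𝓝 μ) := by
  rw [tendsto_subtype_rng]
  let δ : FiniteMeasure X := ⟨Measure.dirac x, inferInstance⟩
  have hc : Continuous fun ε : ℝ≥0 => μ.1 + ε • δ := by fun_prop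
  have h := hc.tendsto 0
  rw [zero_smul, add_zero] at h
  exact h

/-- The nonzero measures with total mass in a compact subset of `(0, ∞)` form a compact set. -/
theorem isCompact_mass_mem_Icc [PseudoMetricSpace X] [CompactSpace X] [T2Space X] [BorelSpace X]
    {δ ρ : ℝ≥0} (hδ : 0 < δ) :
    IsCompact {μ : PosMeasure X | μ.mass ∈ Set.Icc δ ρ} := by
  rw [Subtype.isCompact_iff]
  have h := (isCompact_setOfPred_finiteMeasure_le_of_compactSpace X ρ).inter_right
    (isClosed_le continuous_const FiniteMeasure.continuous_mass :
      IsClosed {μ : FiniteMeasure X | δ ≤ μ.mass})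
  convert h using 1
  ext μ
  constructor
  · rintro ⟨ν, hν, rfl⟩
    exact ⟨hν.2, hν.1⟩
  · rintro ⟨h1, h2⟩
    exact ⟨⟨μ, (FiniteMeasure.mass_nonzero_iff _).1 (hδ.trans_le h2).ne'⟩, ⟨h2, h1⟩, rfl⟩

end Topology

end PosMeasure

/-! ### Continuity for distance functions -/

theorem ContinuousWrt.tendsto {A B ι : Type*} {dA : A → A → ℝ≥0∞} {dB : B → B → ℝ≥0∞} {g : A → B}
    (hg : ContinuousWrt dA dB g) {l : Filter ι} {a : ι → A} {a₀ : A}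
    (h : Tendsto (fun i => dA (a i) a₀) l (𝓝 0)) :
    Tendsto (fun i => dB (g (a i)) (g a₀)) l (𝓝 0) := by
  rw [ENNReal.tendsto_nhds_zero]
  intro ε hε
  obtain ⟨δ, hδ, H⟩ := hg a₀ ε hε
  filter_upwards [h.eventually (gt_mem_nhds hδ)] with i hi
  exact (H _ hi).le

section Pairs

variable {d d' : ℕ} {Ω : Set (E d)}

theorem continuous_of_continuousWrt_W1 [CompactSpace Ω] {f : PosMeasure Ω → PosMeasure (E d')}
    (hf : ContinuousWrt W1 W1 f) : Continuous f :=
  continuous_iff_continuousAt.2 fun _ =>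
    PosMeasure.tendsto_of_W1 (hf.tendsto (PosMeasure.tendsto_W1_iff.2 tendsto_id))

theorem tendsto_pairDist_iff [CompactSpace Ω] {ι : Type*} {l : Filter ι} {p : ι → PosMeasure Ω × Ω}
    {p₀ : PosMeasure Ω × Ω} :
    Tendsto (fun i => pairDist (p i) p₀) l (𝓝 0) ↔ Tendsto p l (𝓝 p₀) := by
  rw [Prod.tendsto_iff, ← PosMeasure.tendsto_W1_iff,
    tendsto_iff_edist_tendsto_0 (f := fun i => (p i).2)]
  constructor
  · intro h
    exact ⟨tendsto_of_tendsto_of_tendsto_of_le_of_le tendsto_const_nhds h (fun _ => zero_le)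
      fun i => le_self_add, tendsto_of_tendsto_of_tendsto_of_le_of_le tendsto_const_nhds h
      (fun _ => zero_le) fun i => le_add_self⟩
  · rintro ⟨h1, h2⟩
    simpa [pairDist] using h1.add h2

theorem continuousWrt_pairDist_iff [CompactSpace Ω] {G : PosMeasure Ω × Ω → E d'} :
    ContinuousWrt pairDist edist G ↔ Continuous G := by
  constructor
  · intro h
    exact continuous_iff_continuousAt.2 fun p =>
      tendsto_iff_edist_tendsto_0.2 (h.tendsto (tendsto_pairDist_iff.2 tendsto_id))
  · intro h p ε hε
    have h1 : Tendsto id (comap (fun q => pairDist q p) (𝓝 0)) (𝓝 p) :=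
      tendsto_pairDist_iff.1 tendsto_comap
    have h2 := (tendsto_iff_edist_tendsto_0.1 ((h.tendsto p).comp h1)).eventually (gt_mem_nhds hε)
    obtain ⟨δ, hδ, H⟩ := (ENNReal.nhds_zero_basis.comap _).eventually_iff.1 h2
    exact ⟨δ, hδ, fun q hq => H hq⟩

/-- A continuous map is uniformly continuous on pairs `(μ, x)` with total masses in a compact
subset of `(0, ∞)`. -/
theorem uniformContinuousOnWrt_of_continuous [CompactSpace Ω] {G : PosMeasure Ω × Ω → E d'}
    (hG : Continuous G) {δ ρ : ℝ≥0} (hδ : 0 < δ) :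
    UniformContinuousOnWrt pairDist edist G (pairSpace Ω (Set.Icc δ ρ)) := by
  intro ε hε
  by_contra! hcon
  -- Along an ultrafilter on which the distance tends to `0`, pairs violating the bound would converge
  -- to a single point, at which `G` jumps.
  let F : Filter ((PosMeasure Ω × Ω) × (PosMeasure Ω × Ω)) :=
    comap (fun q => pairDist q.1 q.2) (𝓝 0) ⊓ 𝓟 {q | q.1 ∈ pairSpace Ω (Set.Icc δ ρ) ∧
      q.2 ∈ pairSpace Ω (Set.Icc δ ρ) ∧ ε ≤ edist (G q.1) (G q.2)}
  have hF : F.NeBot := by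
    rw [((ENNReal.nhds_zero_basis.comap _).inf_principal _).neBot_iff]
    intro r hr
    obtain ⟨a, ha, a', ha', h1, h2⟩ := hcon r hr
    exact ⟨(a, a'), h1, ha, ha', h2⟩
  let U : Ultrafilter _ := @Ultrafilter.of _ F hF
  have hU : (U : Filter _) ≤ F := @Ultrafilter.of_le _ F hF
  have hUp : ∀ᶠ q in (U : Filter ((PosMeasure Ω × Ω) × (PosMeasure Ω × Ω))),
      q.1 ∈ pairSpace Ω (Set.Icc δ ρ) ∧
      q.2 ∈ pairSpace Ω (Set.Icc δ ρ) ∧ ε ≤ edist (G q.1) (G q.2) :=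
    hU (mem_inf_of_right (mem_principal_self _))
  have hUd : Tendsto (fun q : (PosMeasure Ω × Ω) × (PosMeasure Ω × Ω) => pairDist q.1 q.2) U
      (𝓝 0) :=
    tendsto_comap_iff.1 (tendsto_id.mono_left (hU.trans inf_le_left))
  have hK : IsCompact (pairSpace Ω (Set.Icc δ ρ)) := by
    have h := (PosMeasure.isCompact_mass_mem_Icc (X := Ω) (ρ := ρ) hδ).prod
      (isCompact_univ (X := Ω))
    convert h using 1
    ext p
    simp [pairSpace]
  obtain ⟨q, hq, hlim⟩ := (hK.prod hK).ultrafilter_le_nhds U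
    (le_principal_iff.2 (hUp.mono fun q h => ⟨h.1, h.2.1⟩))
  have l1 : Tendsto Prod.fst (U : Filter _) (𝓝 q.1) := (continuous_fst.tendsto q).mono_left hlim
  have l2 : Tendsto Prod.snd (U : Filter _) (𝓝 q.2) := (continuous_snd.tendsto q).mono_left hlim
  have e : q.1 = q.2 := by
    refine Prod.ext ?_ ?_
    · exact PosMeasure.eq_of_tendsto_of_W1 ((continuous_fst.tendsto _).comp l1)
        ((continuous_fst.tendsto _).comp l2) (tendsto_of_tendsto_of_tendsto_of_le_of_le
          tendsto_const_nhds hUd (fun _ => zero_le) fun i => le_self_add)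
    · exact edist_eq_zero.1 (tendsto_nhds_unique (((continuous_snd.tendsto _).comp l1).edist
        ((continuous_snd.tendsto _).comp l2)) (tendsto_of_tendsto_of_tendsto_of_le_of_le
          tendsto_const_nhds hUd (fun _ => zero_le) fun i => le_add_self))
  have l3 := ((hG.tendsto _).comp l1).edist ((hG.tendsto _).comp l2)
  have := ge_of_tendsto l3 (hUp.mono fun q h => h.2.2)
  rw [e, edist_self] at this
  exact hε.not_ge this

end Pairs

/-! ### Dissociated measures -/

/-- `μ` is the sum of the point masses `r * k j` at the points `z j`, and different sets of indices
have different total masses; in particular all `k j` are positive, since the empty set has total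
mass `0`. The points `z j` need not be distinct. -/
structure IsDissociated {X : Type*} [MeasurableSpace X] (μ : PosMeasure X) {m : ℕ} (r : ℝ≥0)
    (k : Fin m → ℕ) (z : Fin m → X) : Prop where
  toMeas_eq : μ.toMeas = ∑ j, (r * k j) • Measure.dirac (z j)
  injective_sum : Function.Injective fun A : Finset (Fin m) => ∑ j ∈ A, k j

section DiracSums

variable {X : Type*} [MeasurableSpace X] {ι : Type*} [Fintype ι]

theorem PosMeasure.mass_eq_sum {μ : PosMeasure X} {w : ι → ℝ≥0} {z : ι → X}
    (h : μ.toMeas = ∑ j, w j • Measure.dirac (z j)) : μ.mass = ∑ j, w j := by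
  have h1 := μ.toMeas_univ
  rw [h, Measure.finsetSum_apply] at h1
  simp only [Measure.smul_apply, measure_univ] at h1
  rw [← ENNReal.coe_inj, ← h1, ENNReal.ofNNReal_finsetSum]
  exact Finset.sum_congr rfl fun j _ => by rw [ENNReal.smul_def, smul_eq_mul, mul_one]

theorem integral_sum_smul_dirac [MeasurableSingletonClass X] (w : ι → ℝ≥0) (z : ι → X)
    (φ : X → ℝ) :
    ∫ x, φ x ∂(∑ j, w j • Measure.dirac (z j)) = ∑ j, (w j : ℝ) * φ (z j) := by
  rw [integral_finsetSum_measure fun j _ => (integrable_dirac (by finiteness)).smul_measure_nnreal]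
  refine Finset.sum_congr rfl fun j _ => ?_
  rw [integral_smul_nnreal_measure, integral_dirac]
  rfl

/-- The finite sum of point masses, as a nonzero finite measure. -/
noncomputable def diracSum (w : ι → ℝ≥0) (z : ι → X) (hw : ∑ j, w j ≠ 0) : PosMeasure X :=
  ⟨⟨∑ j, w j • Measure.dirac (z j), inferInstance⟩, fun h => by
    have h1 : ∑ j, w j • Measure.dirac (z j) = 0 := congrArg Subtype.val h
    have h2 := congrArg (fun μ => μ Set.univ) h1
    simp only [Measure.finsetSum_apply, Measure.smul_apply, measure_univ, Measure.coe_zero,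
      Pi.zero_apply, ENNReal.smul_def, smul_eq_mul, mul_one] at h2
    exact hw (by exact_mod_cast h2)⟩

theorem toMeas_diracSum (w : ι → ℝ≥0) (z : ι → X) (hw : ∑ j, w j ≠ 0) :
    (diracSum w z hw).toMeas = ∑ j, w j • Measure.dirac (z j) := rfl

theorem tendsto_of_toMeas_eq_sum [TopologicalSpace X] [BorelSpace X] {α : Type*} {l : Filter α}
    {μ : α → PosMeasure X} {μ₀ : PosMeasure X} {w : α → ι → ℝ≥0} {w₀ : ι → ℝ≥0} {z : ι → X}
    (hμ : ∀ a, (μ a).toMeas = ∑ j, w a j • Measure.dirac (z j))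
    (hμ₀ : μ₀.toMeas = ∑ j, w₀ j • Measure.dirac (z j))
    (hw : ∀ j, Tendsto (fun a => w a j) l (𝓝 (w₀ j))) : Tendsto μ l (𝓝 μ₀) := by
  let δ : ι → FiniteMeasure X := fun j => ⟨Measure.dirac (z j), inferInstance⟩
  have e : ∀ w : ι → ℝ≥0, ((∑ j, w j • δ j : FiniteMeasure X) : Measure X) =
      ∑ j, w j • Measure.dirac (z j) := fun w => by
    rw [FiniteMeasure.toMeasure_sum]; rfl
  rw [tendsto_subtype_rng]
  have h : Tendsto (fun a => ∑ j, w a j • δ j) l (𝓝 (∑ j, w₀ j • δ j)) :=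
    tendsto_finsetSum _ fun j _ => (hw j).smul_const _
  convert h using 2 with a
  · exact FiniteMeasure.toMeasure_injective ((hμ a).trans (e _).symm)
  · exact FiniteMeasure.toMeasure_injective (hμ₀.trans (e _).symm)

/-- Binary digits: adding the powers of two below `2 ^ m` makes all subset sums different. -/
theorem injective_sum_add_two_pow {m : ℕ} (a : Fin m → ℕ) :
    Function.Injective fun A : Finset (Fin m) => ∑ j ∈ A, (2 ^ m * a j + 2 ^ (j : ℕ)) := by
  have hlt : ∀ A : Finset (Fin m), ∑ j ∈ A, 2 ^ (j : ℕ) < 2 ^ m := fun A => by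
    calc ∑ j ∈ A, 2 ^ (j : ℕ) ≤ ∑ j : Fin m, 2 ^ (j : ℕ) :=
          Finset.sum_le_sum_of_subset (Finset.subset_univ A)
      _ = ∑ j ∈ Finset.range m, 2 ^ j := Fin.sum_univ_eq_sum_range (fun j => 2 ^ j) m
      _ < 2 ^ m := Nat.geomSum_lt le_rfl fun k hk => Finset.mem_range.1 hk
  intro A B h
  have h1 := congrArg (· % 2 ^ m) h
  simp only [Finset.sum_add_distrib, ← Finset.mul_sum, Nat.mul_add_mod, Nat.mod_eq_of_lt (hlt _)]
    at h1
  have h2 : ∑ i ∈ A.map Fin.valEmbedding, 2 ^ i = ∑ i ∈ B.map Fin.valEmbedding, 2 ^ i := by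
    simpa [Finset.sum_map] using h1
  exact Finset.map_injective _ (Finset.geomSum_injective le_rfl h2)

theorem mem_closure_isDissociated_of_sum [TopologicalSpace X] [BorelSpace X] {m : ℕ}
    {μ : PosMeasure X} {w : Fin m → ℝ≥0} {z : Fin m → X}
    (hμ : μ.toMeas = ∑ j, w j • Measure.dirac (z j)) :
    μ ∈ closure {ν : PosMeasure X | ν.mass = μ.mass ∧ ∃ r k, IsDissociated ν r k z} := by
  set c := μ.mass with hc
  have hcw : c = ∑ j, w j := PosMeasure.mass_eq_sum hμ
  have hc0 : c ≠ 0 := μ.mass_ne_zero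
  -- Multiplicities proportional to `w` up to rounding, with a binary label in the last `m` digits.
  let k : ℕ → Fin m → ℕ := fun N j => 2 ^ m * ⌊(w j : ℝ) * N⌋₊ + 2 ^ (j : ℕ)
  have hm : 0 < m := by
    rcases Nat.eq_zero_or_pos m with rfl | h
    · simp [hcw] at hc0
    · exact h
  have hK : ∀ N, 0 < ∑ j, k N j := fun N =>
    Finset.sum_pos (fun j _ => by positivity) ⟨⟨0, hm⟩, Finset.mem_univ _⟩
  let r : ℕ → ℝ≥0 := fun N => c / (∑ j, k N j : ℕ)
  have hrK : ∀ N, ∑ j, r N * k N j = c := fun N => by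
    rw [← Finset.mul_sum, ← Nat.cast_sum]
    exact div_mul_cancel₀ _ (by exact_mod_cast (hK N).ne')
  refine mem_closure_of_tendsto (f := fun N => diracSum (fun j => r N * k N j) z
    (by rw [hrK]; exact hc0)) (b := atTop) ?_ (Eventually.of_forall fun N => ⟨?_, r N, k N, ?_⟩)
  · refine tendsto_of_toMeas_eq_sum (fun N => toMeas_diracSum _ _ _) hμ fun j => ?_
    have hfl : ∀ j, Tendsto (fun N : ℕ => (k N j : ℝ≥0) / N) atTop (𝓝 (2 ^ m * w j)) := by
      intro j
      have h1 : Tendsto (fun N : ℕ => (⌊(w j : ℝ) * N⌋₊ : ℝ≥0) / N) atTop (𝓝 (w j)) := by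
        rw [← NNReal.tendsto_coe]
        push_cast
        exact (tendsto_nat_floor_mul_div_atTop (w j).coe_nonneg).comp tendsto_natCast_atTop_atTop
      have h2 : Tendsto (fun N : ℕ => (2 ^ (j : ℕ) : ℝ≥0) / N) atTop (𝓝 0) :=
        tendsto_const_div_atTop_nhds_zero_nat _
      have h3 := (h1.const_mul (2 ^ m)).add h2
      rw [add_zero] at h3
      refine h3.congr fun N => ?_
      simp only [k]
      push_cast
      rw [add_div, mul_div_assoc]
    have hs : Tendsto (fun N : ℕ => ((∑ j, k N j : ℕ) : ℝ≥0) / N) atTop (𝓝 (2 ^ m * c)) := by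
      rw [hcw, Finset.mul_sum]
      refine (tendsto_finsetSum _ fun j _ => hfl j).congr fun N => ?_
      rw [Nat.cast_sum, Finset.sum_div]
    have h4 := ((hfl j).div hs (by positivity)).const_mul c
    have e : c * (2 ^ m * w j / (2 ^ m * c)) = w j := by
      field_simp
    rw [e] at h4
    refine h4.congr' ?_
    filter_upwards [eventually_gt_atTop 0] with N hN
    have hN' : (N : ℝ≥0) ≠ 0 := by exact_mod_cast hN.ne'
    simp only [r, Pi.div_apply]
    rw [div_div_div_cancel_right₀ hN', mul_div_assoc', div_mul_eq_mul_div]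
  · exact (PosMeasure.mass_eq_sum (toMeas_diracSum _ _ _)).trans (hrK N)
  · exact ⟨toMeas_diracSum _ _ _, injective_sum_add_two_pow _⟩

theorem map_simpleFunc_eq_sum [MeasurableSingletonClass X] (μ : PosMeasure X) (T : SimpleFunc X X) :
    ∃ (m : ℕ) (w : Fin m → ℝ≥0) (z : Fin m → X),
      μ.toMeas.map T = ∑ j, w j • Measure.dirac (z j) := by
  let e := T.range.equivFin.symm
  refine ⟨T.range.card, fun j => μ.1 (T ⁻¹' {(e j : X)}), fun j => e j, ?_⟩
  have h1 : μ.toMeas.map T = ∑ x ∈ T.range, μ.1 (T ⁻¹' {x}) • Measure.dirac x := by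
    refine Measure.ext_of_lintegral _ fun g hg => ?_
    rw [lintegral_map hg T.measurable, lintegral_finsetSum_measure]
    have h2 := (SimpleFunc.lintegral_eq_lintegral (T.map g) μ.toMeas).trans
      (SimpleFunc.map_lintegral g T)
    simp only [SimpleFunc.coe_map, Function.comp_apply] at h2
    rw [h2]
    refine Finset.sum_congr rfl fun x _ => ?_
    rw [lintegral_smul_measure, lintegral_dirac' _ hg, ENNReal.smul_def, smul_eq_mul, mul_comm]
    congr 1
    exact (FiniteMeasure.ennreal_coeFn_eq_coeFn_toMeasure _ _).symm
  rw [h1, ← Finset.sum_coe_sort]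
  exact (Equiv.sum_comp e fun x : T.range => μ.1 (T ⁻¹' {(x : X)}) • Measure.dirac (x : X)).symm

/-- Dissociated measures with a prescribed atom and a prescribed total mass are dense. -/
theorem mem_closure_isDissociated [PseudoEMetricSpace X] [SecondCountableTopology X]
    [BorelSpace X] [MeasurableSingletonClass X] (μ : PosMeasure X) (x : X) :
    μ ∈ closure {ν : PosMeasure X | ν.mass = μ.mass ∧
      ∃ (m : ℕ) (r : ℝ≥0) (k : Fin m → ℕ) (z : Fin m → X),
        IsDissociated ν r k z ∧ ∃ i, z i = x} := by
  let T : ℕ → SimpleFunc X X := fun n =>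
    SimpleFunc.approxOn id measurable_id Set.univ x (Set.mem_univ x) n
  have hT : ∀ y, Tendsto (fun n => T n y) atTop (𝓝 y) := fun y =>
    SimpleFunc.tendsto_approxOn measurable_id (Set.mem_univ x) (by simp)
  choose m w z hz using fun n => map_simpleFunc_eq_sum μ (T n)
  have hmass : ∀ n, ∑ j, w n j = μ.mass := by
    intro n
    have h1 := congrArg (fun ν => ν Set.univ) (hz n)
    simp only [Measure.map_apply (T n).measurable MeasurableSet.univ, Set.preimage_univ,
      μ.toMeas_univ, Measure.finsetSum_apply, Measure.smul_apply, measure_univ,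
      ENNReal.smul_def, smul_eq_mul, mul_one] at h1
    exact_mod_cast h1.symm
  have hcl : ∀ n, diracSum (w n) (z n) (by rw [hmass]; exact μ.mass_ne_zero) ∈
      closure {ν : PosMeasure X | ν.mass = μ.mass ∧
        ∃ (m : ℕ) (r : ℝ≥0) (k : Fin m → ℕ) (z : Fin m → X),
          IsDissociated ν r k z ∧ ∃ i, z i = x} := by
    intro n
    have h1 := mem_closure_isDissociated_of_sum
      (μ := diracSum (w n) (z n) (by rw [hmass]; exact μ.mass_ne_zero))
      (w := Fin.cons 0 (w n)) (z := Fin.cons x (z n)) (by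
        rw [toMeas_diracSum, Fin.sum_univ_succ]
        simp)
    refine closure_mono ?_ h1
    rintro ν ⟨hν, r, k, hk⟩
    refine ⟨hν.trans ((PosMeasure.mass_eq_sum (toMeas_diracSum _ _ _)).trans (hmass n)), _, r, k, _,
      hk, 0, rfl⟩
  refine isClosed_closure.mem_of_tendsto ?_ (Eventually.of_forall hcl) (b := atTop)
  rw [tendsto_subtype_rng, FiniteMeasure.tendsto_iff_forall_integral_tendsto]
  intro φ
  have h1 : ∀ n, ∫ y, φ y ∂(diracSum (w n) (z n) (by rw [hmass]; exact μ.mass_ne_zero)).toMeas =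
      ∫ y, φ (T n y) ∂μ.toMeas := by
    intro n
    rw [toMeas_diracSum, ← hz n, integral_map (T n).measurable.aemeasurable
      φ.continuous.measurable.aestronglyMeasurable]
  refine Tendsto.congr (fun n => (h1 n).symm) ?_
  refine tendsto_integral_of_dominated_convergence (fun _ => ‖φ‖)
    (fun n => (φ.continuous.measurable.comp (T n).measurable).aestronglyMeasurable)
    (integrable_const _) (fun n => Eventually.of_forall fun y => φ.norm_coe_le_norm _)
    (Eventually.of_forall fun y => (φ.continuous.tendsto y).comp (hT y))

end DiracSums

theorem exists_seq_isDissociated {X : Type*} [MeasurableSpace X] [MetricSpace X]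
    [CompactSpace X] [BorelSpace X] (μ : PosMeasure X) (x : X) :
    ∃ ν : ℕ → PosMeasure X, Tendsto (fun n => W1 (ν n) μ) atTop (𝓝 0) ∧
      ∀ n, (ν n).mass = μ.mass ∧ ∃ (m : ℕ) (r : ℝ≥0) (k : Fin m → ℕ) (z : Fin m → X),
        IsDissociated (ν n) r k z ∧ ∃ i, z i = x := by
  have h1 : ∀ n : ℕ, ∀ᶠ ν in 𝓝 μ, W1 ν μ < ((n : ℝ≥0∞) + 1)⁻¹ := fun n =>
    (PosMeasure.tendsto_W1_iff.2 (tendsto_id (x := 𝓝 μ))).eventually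
      (gt_mem_nhds (ENNReal.inv_pos.2 (by finiteness)))
  choose ν hν hS using fun n => ((mem_closure_iff_frequently.1
    (mem_closure_isDissociated μ x)).and_eventually (h1 n)).exists.imp fun _ h => h.symm
  refine ⟨ν, ?_, hS⟩
  refine tendsto_of_tendsto_of_tendsto_of_le_of_le tendsto_const_nhds ?_ (fun _ => zero_le)
    fun n => (hν n).le
  have := (tendsto_add_atTop_iff_nat 1).2 ENNReal.tendsto_inv_nat_nhds_zero
  simpa using this

/-! ### Test functions -/

section TestFunctions

variable {n : ℕ}

theorem edist_le_supDist (ψ₁ ψ₂ : TestFun n) (y : E n) : edist (ψ₁.1 y) (ψ₂.1 y) ≤ supDist ψ₁ ψ₂ :=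
  le_iSup (fun y => edist (ψ₁.1 y) (ψ₂.1 y)) y

theorem supDist_self (ψ : TestFun n) : supDist ψ ψ = 0 := by
  simp [supDist]

theorem tendsto_apply_of_supDist {ι : Type*} {l : Filter ι} {ψ : ι → TestFun n} {ψ₀ : TestFun n}
    (h : Tendsto (fun i => supDist (ψ i) ψ₀) l (𝓝 0)) {y : ι → E n} {y₀ : E n}
    (hy : Tendsto y l (𝓝 y₀)) : Tendsto (fun i => (ψ i).1 (y i)) l (𝓝 (ψ₀.1 y₀)) := by
  have h1 : Tendsto (fun i => edist ((ψ i).1 (y i)) (ψ₀.1 (y i)) + edist (ψ₀.1 (y i)) (ψ₀.1 y₀))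
      l (𝓝 (0 + 0)) :=
    (tendsto_of_tendsto_of_tendsto_of_le_of_le tendsto_const_nhds h (fun _ => zero_le)
      fun i => edist_le_supDist _ _ _).add
      (tendsto_iff_edist_tendsto_0.1 ((ψ₀.2.1.continuous.tendsto y₀).comp hy))
  rw [add_zero] at h1
  exact tendsto_iff_edist_tendsto_0.2 (tendsto_of_tendsto_of_tendsto_of_le_of_le
    tendsto_const_nhds h1 (fun _ => zero_le) fun i => edist_triangle _ _ _)

/-- Test functions that are constant near each of finitely many points are uniformly dense. -/
theorem exists_testFun_eventually_eq (ψ : TestFun n) (Y : Finset (E n)) {ε : ℝ} (hε : 0 < ε) :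
    ∃ ψ' : TestFun n, (∀ y, |ψ'.1 y - ψ.1 y| ≤ ε) ∧ ∀ v ∈ Y, ∀ᶠ z in 𝓝 v, ψ'.1 z = ψ'.1 v := by
  classical
  induction Y using Finset.induction_on generalizing ε with
  | empty => exact ⟨ψ, fun y => by simpa using hε.le, by simp⟩
  | insert v Y hv ih =>
    obtain ⟨ψ₁, h1, h2⟩ := ih (half_pos hε)
    have hU : {z | |ψ₁.1 z - ψ₁.1 v| < ε / 2} ∩ (Y : Set (E n))ᶜ ∈ 𝓝 v := by
      refine inter_mem ?_ (Y.finite_toSet.isClosed.isOpen_compl.mem_nhds (by simpa using hv))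
      have := (ψ₁.2.1.continuous.tendsto v).eventually (Metric.ball_mem_nhds _ (half_pos hε))
      exact this
    obtain ⟨s, hs, hsub⟩ := Metric.nhds_basis_closedBall.mem_iff.1 hU
    let b : ContDiffBump v := ⟨s / 2, s, half_pos hs, half_lt_self hs⟩
    refine ⟨⟨fun z => ψ₁.1 z + b z * (ψ₁.1 v - ψ₁.1 z), ?_, ?_⟩, ?_, ?_⟩
    · exact ψ₁.2.1.add (b.contDiff.mul (contDiff_const.sub ψ₁.2.1))
    · exact ψ₁.2.2.add b.hasCompactSupport.mul_right
    · intro y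
      have h3 : |b y * (ψ₁.1 v - ψ₁.1 y)| ≤ ε / 2 := by
        by_cases hy : y ∈ Metric.closedBall v s
        · have h4 : |ψ₁.1 y - ψ₁.1 v| < ε / 2 := (hsub hy).1
          rw [abs_mul, abs_of_nonneg b.nonneg, abs_sub_comm]
          exact (mul_le_of_le_one_left (abs_nonneg _) b.le_one).trans h4.le
        · rw [b.zero_of_le_dist (not_le.1 hy).le, zero_mul, abs_zero]
          exact (half_pos hε).le
      have e : ψ₁.1 y + b y * (ψ₁.1 v - ψ₁.1 y) - ψ.1 y =
          (ψ₁.1 y - ψ.1 y) + b y * (ψ₁.1 v - ψ₁.1 y) := by ring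
      calc _ = |(ψ₁.1 y - ψ.1 y) + b y * (ψ₁.1 v - ψ₁.1 y)| := by rw [e]
        _ ≤ ε / 2 + ε / 2 := (abs_add_le _ _).trans (add_le_add (h1 y) h3)
        _ = ε := add_halves ε
    · intro u hu
      rcases Finset.mem_insert.1 hu with rfl | hu
      · filter_upwards [b.eventuallyEq_one] with z hz
        simp [hz]
      · have hout : ∀ᶠ z in 𝓝 u, b z = 0 := by
          have : (Metric.closedBall v s)ᶜ ∈ 𝓝 u :=
            Metric.isClosed_closedBall.isOpen_compl.mem_nhds fun hmem => (hsub hmem).2 hu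
          filter_upwards [this] with z hz
          exact b.zero_of_le_dist (not_le.1 fun h => hz (Metric.mem_closedBall.2 h)).le
        filter_upwards [hout, h2 u hu] with z hz hz'
        simp [hz, hz', hout.self_of_nhds]

theorem locallyConstantNearSupport_of_sum {ι : Type*} [Fintype ι] {ν : PosMeasure (E n)}
    {w : ι → ℝ≥0} {y : ι → E n} (hν : ν.toMeas = ∑ j, w j • Measure.dirac (y j)) {ψ : TestFun n}
    (hψ : ∀ j, ∀ᶠ z in 𝓝 (y j), ψ.1 z = ψ.1 (y j)) : LocallyConstantNearSupport ψ ν := by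
  refine ⟨{u | ∀ᶠ z in 𝓝 u, ψ.1 z = ψ.1 u}, ?_, ?_, fun _ h => h⟩
  · rw [isOpen_iff_mem_nhds]
    intro u hu
    have hu' : ∀ᶠ z in 𝓝 u, ψ.1 z = ψ.1 u := hu
    filter_upwards [hu'.eventually_nhds] with v hv
    have := hv.self_of_nhds
    filter_upwards [hv] with z hz
    rw [hz, this]
  · refine (Measure.support_subset_of_isClosed (t := Set.range y)
      (Set.finite_range y).isClosed ?_).trans
      (by rintro _ ⟨j, rfl⟩; exact hψ j)
    rw [hν]
    change ∀ᵐ u ∂(∑ j, w j • Measure.dirac (y j)), u ∈ Set.range y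
    rw [ae_finsetSum_measure_iff]
    intro j _
    refine Measure.ae_smul_measure ?_ _
    exact (ae_dirac_iff (p := (· ∈ Set.range y)) (Set.finite_range y).measurableSet).2 ⟨j, rfl⟩

/-- Near a finitely supported measure, every test function is a uniform limit of admissible ones. -/
theorem exists_testFun_locallyConstant {ι : Type*} [Fintype ι] {ν : PosMeasure (E n)}
    {w : ι → ℝ≥0} {y : ι → E n} (hν : ν.toMeas = ∑ j, w j • Measure.dirac (y j)) (ψ : TestFun n)
    (k : ℕ) : ∃ ψ' : TestFun n, supDist ψ' ψ ≤ (k : ℝ≥0∞)⁻¹ ∧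
      LocallyConstantNearSupport ψ' ν ∧ ∀ j, ∀ᶠ z in 𝓝 (y j), ψ'.1 z = ψ'.1 (y j) := by
  classical
  obtain ⟨ψ', h1, h2⟩ := exists_testFun_eventually_eq ψ (Finset.univ.image y)
    (ε := ((k : ℝ) + 1)⁻¹) (by positivity)
  have h3 : ∀ j, ∀ᶠ z in 𝓝 (y j), ψ'.1 z = ψ'.1 (y j) := fun j => h2 _ (by simp)
  refine ⟨ψ', iSup_le fun z => ?_, locallyConstantNearSupport_of_sum hν h3, h3⟩
  rw [edist_dist, Real.dist_eq]
  refine (ENNReal.ofReal_le_ofReal (h1 z)).trans ?_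
  rw [ENNReal.ofReal_inv_of_pos (by positivity), ENNReal.inv_le_inv,
    ENNReal.ofReal_add (by positivity) zero_le_one, ENNReal.ofReal_natCast]
  exact le_self_add

/-- Test functions with a Lipschitz bound recover the distance of two points, up to a constant. -/
theorem exists_testFun_separating (n : ℕ) {η : ℝ≥0} (hη : 0 < η) :
    ∃ κ : ℝ≥0, 0 < κ ∧ ∀ a b : E n, ∃ ψ : TestFun n, LipschitzWith η ψ.1 ∧
      κ * edist a b ≤ edist (ψ.1 a) (ψ.1 b) := by
  let φ : ContDiffBump (0 : E n) := ⟨1 / 2, 1, by norm_num, by norm_num⟩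
  obtain ⟨C, hC⟩ := ContDiff.lipschitzWith_of_hasCompactSupport (𝕂 := ℝ) (n := 1)
    φ.hasCompactSupport φ.contDiff one_ne_zero
  refine ⟨η / (C + 1), by positivity, fun a b => ?_⟩
  rcases eq_or_ne a b with rfl | hab
  · exact ⟨⟨0, contDiff_const, HasCompactSupport.zero⟩, (LipschitzWith.const 0).weaken zero_le,
      by simp⟩
  set R : ℝ≥0 := nndist a b with hR
  have hR0 : R ≠ 0 := by simpa [hR, nndist_eq_zero] using hab
  have hR0' : (R : ℝ) ≠ 0 := by exact_mod_cast hR0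
  let e : E n ≃ₜ E n := (Homeomorph.addRight (-a)).trans
    (Homeomorph.smulOfNeZero ((R : ℝ)⁻¹) (inv_ne_zero hR0'))
  have he : ∀ z, e z = (R : ℝ)⁻¹ • (z + -a) := fun z => rfl
  let s : ℝ≥0 := η * R / (C + 1)
  have hlip_e : LipschitzWith R⁻¹ e := by
    refine LipschitzWith.of_dist_le_mul fun z z' => ?_
    rw [he, he, dist_smul₀, dist_add_right, Real.norm_eq_abs, abs_of_nonneg (by positivity)]
    simp
  refine ⟨⟨fun z => (s : ℝ) * φ (e z), ?_, ?_⟩, ?_, ?_⟩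
  · have : ContDiff ℝ 1 fun z : E n => (R : ℝ)⁻¹ • (z + -a) := by fun_prop
    exact contDiff_const.mul (φ.contDiff.comp this)
  · exact (φ.hasCompactSupport.comp_homeomorph e).mul_left
  · have h1 : LipschitzWith (s * (C * R⁻¹)) fun z => (s : ℝ) * φ (e z) := by
      refine LipschitzWith.of_dist_le_mul fun z z' => ?_
      have h2 := (hC.comp hlip_e).dist_le_mul z z'
      simp only [Function.comp] at h2
      rw [dist_eq_norm, ← mul_sub, norm_mul, ← dist_eq_norm]
      push_cast at h2 ⊢
      rw [Real.norm_eq_abs, NNReal.abs_eq, mul_assoc]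
      exact mul_le_mul_of_nonneg_left h2 s.coe_nonneg
    refine h1.weaken ?_
    have e1 : s * (C * R⁻¹) = η * (C / (C + 1)) := by
      simp only [s]; field_simp
    rw [e1]
    exact mul_le_of_le_one_right' (div_le_one_of_le₀ le_self_add zero_le)
  · have h1 : φ (e a) = 1 := by
      rw [he, add_neg_cancel, smul_zero]
      exact φ.one_of_mem_closedBall (Metric.mem_closedBall_self (by norm_num))
    have h2 : φ (e b) = 0 := by
      apply φ.zero_of_le_dist
      rw [he, dist_zero_right, norm_smul, norm_inv, ← sub_eq_add_neg, ← dist_eq_norm, dist_comm b a]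
      have : ‖(R : ℝ)‖ = dist a b := by rw [Real.norm_eq_abs, NNReal.abs_eq, hR, coe_nndist]
      rw [this, inv_mul_cancel₀ (by rwa [hR, coe_nndist] at hR0')]
    simp only [h1, h2, mul_one, mul_zero]
    rw [edist_nndist, edist_nndist, ← ENNReal.coe_mul]
    have h3 : nndist (s : ℝ) 0 = s := by
      rw [← NNReal.coe_inj, coe_nndist, dist_zero_right, Real.norm_eq_abs, NNReal.abs_eq]
    rw [h3, ← hR]
    refine le_of_eq ?_
    simp only [s]
    rw [div_mul_eq_mul_div]

end TestFunctions

/-! ### Support-preserving maps at dissociated measures -/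

section SupportPreserving

variable {d d' : ℕ} {Ω : Set (E d)} {f : PosMeasure Ω → PosMeasure (E d')}

/-- Support preservation for atoms with commensurable weights, which are split into atoms of equal
weight. -/
theorem SupportPreserving.exists_of_sum (hf : SupportPreserving f) {m : ℕ} {μ : PosMeasure Ω}
    {r : ℝ≥0} {k : Fin m → ℕ} {x : Fin m → Ω}
    (hμ : μ.toMeas = ∑ j, (r * k j) • Measure.dirac (x j)) :
    ∃ y : Fin m → E d', (f μ).toMeas = ∑ j, (r * k j) • Measure.dirac (y j) := by
  have hsum : r * (∑ j, k j : ℕ) ≠ 0 := by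
    have h1 := PosMeasure.mass_eq_sum hμ
    rw [← Finset.mul_sum, ← Nat.cast_sum] at h1
    rw [← h1]
    exact μ.mass_ne_zero
  have hr : r ≠ 0 := left_ne_zero_of_mul hsum
  have hn : ((∑ j, k j : ℕ) : ℝ≥0) ≠ 0 := right_ne_zero_of_mul hsum
  let e : (Σ j, Fin (k j)) ≃ Fin (∑ j, k j) := finSigmaFinEquiv
  have hsplit : ∀ {Y : Type} [MeasurableSpace Y] (y : Fin m → Y),
      ∑ j, (r * k j) • Measure.dirac (y j) =
        ∑ a, (r * (∑ j, k j : ℕ) / (∑ j, k j : ℕ)) • Measure.dirac (y (e.symm a).1) := by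
    intro Y _ y
    rw [mul_div_cancel_right₀ _ hn, ← Equiv.sum_comp e, Fintype.sum_sigma]
    refine Finset.sum_congr rfl fun j _ => ?_
    simp only [Equiv.symm_apply_apply, Finset.sum_const, Finset.card_univ, Fintype.card_fin]
    rw [mul_comm, mul_smul, Nat.cast_smul_eq_nsmul]
  obtain ⟨y, hy, hyx⟩ := hf (∑ j, k j) (r * (∑ j, k j : ℕ)) (fun a => x (e.symm a).1) μ
    (pos_iff_ne_zero.2 hsum) (hμ.trans (hsplit x))
  let y' : Fin m → E d' := fun j => if h : 0 < k j then y (e ⟨j, ⟨0, h⟩⟩) else 0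
  refine ⟨y', hy.trans ?_⟩
  rw [hsplit y']
  refine Finset.sum_congr rfl fun a _ => ?_
  have hpos : 0 < k (e.symm a).1 := (e.symm a).2.pos
  have : y' (e.symm a).1 = y a := by
    simp only [y', dif_pos hpos]
    exact hyx _ _ (by simp)
  rw [this]

/-- If different sets of weights have different totals, then the atoms of a sum of point masses
can be recovered from the measure. -/
theorem eq_of_sum_smul_dirac_eq {Y : Type*} [MeasurableSpace Y] [MeasurableSingletonClass Y]
    {m : ℕ} {r : ℝ≥0} (hr : r ≠ 0) {k : Fin m → ℕ}
    (hk : Function.Injective fun A : Finset (Fin m) => ∑ j ∈ A, k j) {y z : Fin m → Y}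
    (h : ∑ j, (r * k j) • Measure.dirac (y j) = ∑ j, (r * k j) • Measure.dirac (z j)) : y = z := by
  classical
  have hval : ∀ (y : Fin m → Y) (v : Y), (∑ j, (r * k j) • Measure.dirac (y j)) {v} =
      ((r * (∑ j ∈ Finset.univ.filter (fun j => y j = v), k j : ℕ) : ℝ≥0) : ℝ≥0∞) := by
    intro y v
    rw [Measure.finsetSum_apply, Finset.sum_filter]
    push_cast
    rw [Finset.mul_sum]
    refine Finset.sum_congr rfl fun j _ => ?_
    rw [Pi.smul_apply, Measure.dirac_apply, ENNReal.smul_def, smul_eq_mul]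
    by_cases hj : y j = v <;> simp [hj]
  funext i
  have h1 := hval y (z i)
  rw [h, hval z (z i), ENNReal.coe_inj, mul_right_inj' hr, Nat.cast_inj] at h1
  have h2 := hk h1
  have h3 : i ∈ Finset.univ.filter (fun j => z j = z i) := by simp
  rw [h2] at h3
  simpa using h3

/-- Under a small perturbation of the weights, the image of a dissociated measure has, along a
subsequence, atoms that converge to the atoms with the same labels. -/
theorem exists_subseq_tendsto_atoms {m : ℕ} {r : ℝ≥0} (hr : r ≠ 0) {k : Fin m → ℕ}
    (hk : Function.Injective fun A : Finset (Fin m) => ∑ j ∈ A, k j)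
    {ν : ℕ → PosMeasure (E d')} {ν₀ : PosMeasure (E d')} {y : ℕ → Fin m → E d'} {y₀ : Fin m → E d'}
    {w : ℕ → Fin m → ℝ≥0} (hν : ∀ N, (ν N).toMeas = ∑ j, w N j • Measure.dirac (y N j))
    (hν₀ : ν₀.toMeas = ∑ j, (r * k j) • Measure.dirac (y₀ j))
    (hw : ∀ j, Tendsto (fun N => w N j) atTop (𝓝 (r * k j))) (hlim : Tendsto ν atTop (𝓝 ν₀)) :
    ∃ τ : ℕ → ℕ, StrictMono τ ∧ Tendsto (y ∘ τ) atTop (𝓝 y₀) := by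
  have hkpos : ∀ j, k j ≠ 0 := by
    intro j hj
    have : (∅ : Finset (Fin m)) = {j} := hk (by simp [hj])
    simp at this
  have hint : ∀ φ : BoundedContinuousFunction (E d') ℝ,
      Tendsto (fun N => ∑ j, (w N j : ℝ) * φ (y N j)) atTop
        (𝓝 (∑ j, ((r * k j : ℝ≥0) : ℝ) * φ (y₀ j))) := by
    intro φ
    have h := PosMeasure.tendsto_integral hlim φ
    simp_rw [hν, hν₀, integral_sum_smul_dirac] at h
    exact h
  -- The atoms stay close to the range of `y₀`: test against the truncated distance to it.
  have hdist : ∀ j, ∀ᶠ N in atTop, y N j ∈ Metric.thickening 1 (Set.range y₀) := by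
    intro j
    have : Nonempty (Fin m) := ⟨j⟩
    let φ : BoundedContinuousFunction (E d') ℝ :=
      BoundedContinuousFunction.mkOfBound
        ⟨fun z => min 1 (Metric.infDist z (Set.range y₀)),
          continuous_const.min (Metric.continuous_infDist_pt _)⟩ 1 (by
          intro a b
          have ha : 0 ≤ min 1 (Metric.infDist a (Set.range y₀)) :=
            le_min zero_le_one Metric.infDist_nonneg
          have hb : 0 ≤ min 1 (Metric.infDist b (Set.range y₀)) :=
            le_min zero_le_one Metric.infDist_nonneg
          have ha' := min_le_left 1 (Metric.infDist a (Set.range y₀))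
          have hb' := min_le_left 1 (Metric.infDist b (Set.range y₀))
          change |min 1 (Metric.infDist a (Set.range y₀)) -
            min 1 (Metric.infDist b (Set.range y₀))| ≤ 1
          rw [abs_le]
          constructor <;> linarith)
    have hφ : ∀ z, φ z = min 1 (Metric.infDist z (Set.range y₀)) := fun z => rfl
    have hφ0 : ∀ z, 0 ≤ φ z := fun z => le_min zero_le_one Metric.infDist_nonneg
    have h0 : ∑ j, ((r * k j : ℝ≥0) : ℝ) * φ (y₀ j) = 0 := by
      refine Finset.sum_eq_zero fun j _ => ?_
      rw [hφ, Metric.infDist_zero_of_mem (Set.mem_range_self j)]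
      simp
    have h1 := hint φ
    rw [h0] at h1
    have hpos : (0 : ℝ) < ((r * k j : ℝ≥0) : ℝ) := by
      have := hkpos j
      positivity
    have hw' := ((NNReal.continuous_coe.tendsto _).comp (hw j))
    filter_upwards [h1.eventually (gt_mem_nhds (half_pos hpos)),
      hw'.eventually (lt_mem_nhds (half_lt_self hpos))] with N hN1 hN2
    have h2 : (w N j : ℝ) * φ (y N j) ≤ ∑ j, (w N j : ℝ) * φ (y N j) :=
      Finset.single_le_sum (f := fun j => (w N j : ℝ) * φ (y N j))
        (fun j _ => mul_nonneg (w N j).coe_nonneg (hφ0 _)) (Finset.mem_univ j)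
    simp only [Function.comp] at hN2
    have h3 : φ (y N j) < 1 := by
      by_contra hcon
      nlinarith [hφ0 (y N j)]
    rw [hφ] at h3
    rw [Metric.mem_thickening_iff_infDist_lt (Set.range_nonempty y₀)]
    exact (min_lt_iff.1 h3).resolve_left (lt_irrefl _)
  have hbd : Bornology.IsBounded
      (Set.univ.pi fun _ : Fin m => Metric.thickening 1 (Set.range y₀)) :=
    Bornology.IsBounded.pi fun _ => (Set.finite_range y₀).isBounded.thickening
  obtain ⟨z, _, τ, hτ, hz⟩ := tendsto_subseq_of_frequently_bounded hbd (x := y)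
    ((eventually_all.2 hdist).mono fun N hN => by simpa using hN).frequently
  refine ⟨τ, hτ, ?_⟩
  have hzj : ∀ j, Tendsto (fun N => y (τ N) j) atTop (𝓝 (z j)) := fun j =>
    (tendsto_pi_nhds.1 hz) j
  have hmeas : ∑ j, (r * k j) • Measure.dirac (y₀ j) = ∑ j, (r * k j) • Measure.dirac (z j) := by
    refine ext_of_forall_integral_eq_of_IsFiniteMeasure fun φ => ?_
    rw [integral_sum_smul_dirac, integral_sum_smul_dirac]
    refine tendsto_nhds_unique ((hint φ).comp hτ.tendsto_atTop) ?_
    refine tendsto_finsetSum _ fun j _ => ?_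
    exact ((NNReal.continuous_coe.tendsto _).comp ((hw j).comp hτ.tendsto_atTop)).mul
      ((φ.continuous.tendsto _).comp (hzj j))
  rw [eq_of_sum_smul_dirac_eq hr hk hmeas]
  exact hz

/-- At a dissociated measure the regular part of the derivative at an atom is the evaluation of the
test function at the atom of the image that carries the same label. -/
theorem IsDissociated.exists_regularPart [CompactSpace Ω] (hfc : Continuous f)
    (hf : SupportPreserving f) {m : ℕ} {μ : PosMeasure Ω} {r : ℝ≥0} {k : Fin m → ℕ} {x : Fin m → Ω}
    (h : IsDissociated μ r k x) :
    ∃ y : Fin m → E d', (f μ).toMeas = ∑ j, (r * k j) • Measure.dirac (y j) ∧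
      ∀ i ψ L, HasRegularPart f (μ, x i, ψ) L → L = ψ.1 (y i) := by
  obtain ⟨y₀, hy₀⟩ := hf.exists_of_sum h.toMeas_eq
  refine ⟨y₀, hy₀, fun i ψ L hL => ?_⟩
  have hr : r ≠ 0 := by
    rintro rfl
    exact μ.toMeas_ne_zero (by simp [h.toMeas_eq])
  -- Perturbation by `r / (N + 1)` keeps the weights commensurable.
  let ε : ℕ → ℝ≥0 := fun N => r / (N + 1)
  have hε0 : ∀ N, ε N ≠ 0 := fun N => by positivity
  have hε : Tendsto ε atTop (𝓝 0) := by
    have := (tendsto_add_atTop_iff_nat 1).2 (tendsto_const_div_atTop_nhds_zero_nat r)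
    simpa [ε] using this
  let w : ℕ → Fin m → ℝ≥0 := fun N j => r * k j + if j = i then ε N else 0
  have hwk : ∀ N j, w N j = ε N * ((N + 1) * k j + if j = i then 1 else 0 : ℕ) := by
    intro N j
    have : ε N * ((N : ℝ≥0) + 1) = r := div_mul_cancel₀ _ (by positivity)
    simp only [w]
    push_cast
    rw [mul_add, ← mul_assoc, this, mul_ite, mul_one, mul_zero]
  have hν : ∀ N, (μ.addDirac (ε N) (x i)).toMeas = ∑ j, w N j • Measure.dirac (x j) := by
    intro N
    change μ.toMeas + ε N • Measure.dirac (x i) = _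
    simp only [w, add_smul, Finset.sum_add_distrib, ite_smul, zero_smul, Finset.sum_ite_eq',
      Finset.mem_univ, if_true, h.toMeas_eq]
  have hex : ∀ N, ∃ y : Fin m → E d', (f (μ.addDirac (ε N) (x i))).toMeas =
      ∑ j, w N j • Measure.dirac (y j) := by
    intro N
    simp only [hwk]
    refine hf.exists_of_sum (x := x) ?_
    rw [hν]
    simp only [hwk]
  choose y hy using hex
  obtain ⟨τ, hτ, hyτ⟩ := exists_subseq_tendsto_atoms hr h.injective_sum hy hy₀ (fun j => by
      have h1 : Tendsto (fun N => if j = i then ε N else 0) atTop (𝓝 0) := by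
        split_ifs
        · exact hε
        · exact tendsto_const_nhds
      simpa [w] using (tendsto_const_nhds (x := r * (k j : ℝ≥0))).add h1)
    ((hfc.tendsto μ).comp ((μ.tendsto_addDirac (x i)).comp hε))
  choose ψk hψ1 hψ2 hψ3 using exists_testFun_locallyConstant hy₀ ψ
  have hψlim : Tendsto (fun n => supDist (ψk n) ψ) atTop (𝓝 0) :=
    tendsto_of_tendsto_of_tendsto_of_le_of_le tendsto_const_nhds ENNReal.tendsto_inv_nat_nhds_zero
      (fun _ => zero_le) hψ1
  obtain ⟨Lk, hLk, hLlim⟩ := hL (fun _ => μ) ψk hψ2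
    (PosMeasure.tendsto_W1_iff.2 tendsto_const_nhds) hψlim
  have hLk_eq : ∀ n, Lk n = (ψk n).1 (y₀ i) := by
    intro n
    have hετ : Tendsto (fun N => ε (τ N)) atTop (𝓝[>] 0) :=
      tendsto_nhdsWithin_iff.2 ⟨hε.comp hτ.tendsto_atTop,
        Eventually.of_forall fun N => pos_iff_ne_zero.2 (hε0 _)⟩
    refine tendsto_nhds_unique ((hLk n).comp hετ) ?_
    have hev : ∀ᶠ N in atTop, ∀ j, (ψk n).1 (y (τ N) j) = (ψk n).1 (y₀ j) :=
      eventually_all.2 fun j => ((tendsto_pi_nhds.1 hyτ) j).eventually (hψ3 n j)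
    refine tendsto_const_nhds.congr' ?_
    filter_upwards [hev] with N hN
    have hε' : ((ε (τ N) : ℝ≥0) : ℝ) ≠ 0 := by exact_mod_cast hε0 _
    simp only [Function.comp, diffQuotient]
    rw [hy, hy₀, integral_sum_smul_dirac, integral_sum_smul_dirac, eq_div_iff hε',
      ← Finset.sum_sub_distrib]
    simp only [hN, w]
    rw [Finset.sum_eq_single i]
    · push_cast; rw [if_pos rfl]; ring
    · intro j _ hj
      rw [if_neg hj]; push_cast; ring
    · simp
  refine tendsto_nhds_unique hLlim ?_
  exact (tendsto_apply_of_supDist hψlim tendsto_const_nhds).congr fun n => (hLk_eq n).symm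

/-- The regular part of the derivative of a support-preserving map is unique. -/
theorem HasRegularPart.unique [CompactSpace Ω] (hf : SupportPreserving f)
    {p : PosMeasure Ω × Ω × TestFun d'} {L L' : ℝ} (hL : HasRegularPart f p L)
    (hL' : HasRegularPart f p L') : L = L' := by
  obtain ⟨ν, hν, hdis⟩ := exists_seq_isDissociated p.1 p.2.1
  have hex : ∀ n : ℕ, ∃ ψ' : TestFun d', supDist ψ' p.2.2 ≤ (n : ℝ≥0∞)⁻¹ ∧
      LocallyConstantNearSupport ψ' (f (ν n)) := by
    intro n
    obtain ⟨-, m, r, k, z, hz, -⟩ := hdis n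
    obtain ⟨y, hy⟩ := hf.exists_of_sum hz.toMeas_eq
    obtain ⟨ψ', h1, h2, -⟩ := exists_testFun_locallyConstant hy p.2.2 n
    exact ⟨ψ', h1, h2⟩
  choose ψk hψ1 hψ2 using hex
  have hψlim : Tendsto (fun n => supDist (ψk n) p.2.2) atTop (𝓝 0) :=
    tendsto_of_tendsto_of_tendsto_of_le_of_le tendsto_const_nhds ENNReal.tendsto_inv_nat_nhds_zero
      (fun _ => zero_le) hψ1
  obtain ⟨Lk, h1, h2⟩ := hL ν ψk hψ2 hν hψlim
  obtain ⟨Lk', h1', h2'⟩ := hL' ν ψk hψ2 hν hψlim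
  have : Lk = Lk' := funext fun n => tendsto_nhds_unique (h1 n) (h1' n)
  exact tendsto_nhds_unique h2 (this ▸ h2')

end SupportPreserving

/-! ### The regular part of the derivative of an in-context map -/

section GivenBy

variable {d d' : ℕ} {Ω : Set (E d)} {f : PosMeasure Ω → PosMeasure (E d')}
  {G : PosMeasure Ω × Ω → E d'}

theorem IsGivenBy.supportPreserving (h : IsGivenBy f G) : SupportPreserving f := by
  intro n c x μ _ hμ
  refine ⟨fun i => G (μ, x i), ?_, fun i j hij => by simp only [hij]⟩
  rw [(h μ).2, hμ, Measure.map_finset_sum (h μ).1.aemeasurable]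
  refine Finset.sum_congr rfl fun i _ => ?_
  rw [Measure.map_smul, Measure.map_dirac' (h μ).1]

theorem map_mem_support {X Y : Type*} [MeasurableSpace X] [TopologicalSpace X]
    [OpensMeasurableSpace X] [MeasurableSpace Y] [TopologicalSpace Y] [BorelSpace Y] {μ : Measure X}
    {g : X → Y}
    (hg : Continuous g) {x : X} (hx : x ∈ μ.support) : g x ∈ (μ.map g).support := by
  rw [Measure.mem_support_iff_forall] at hx ⊢
  intro V hV
  exact (hx _ (hg.continuousAt hV)).trans_le (Measure.le_map_apply hg.measurable.aemeasurable V)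

variable [CompactSpace Ω]

/-- Adding a small point mass at `x` moves the points `G (μ, y)` only within the region where `ψ`
is locally constant, so that just the new atom contributes to the difference quotient. -/
theorem IsGivenBy.tendsto_diffQuotient (h : IsGivenBy f G) (hG : Continuous G) {μ : PosMeasure Ω}
    (x : Ω) {ψ : TestFun d'} (hψ : LocallyConstantNearSupport ψ (f μ)) :
    Tendsto (fun ε : ℝ≥0 => diffQuotient f μ x ψ ε) (𝓝[>] 0) (𝓝 (ψ.1 (G (μ, x)))) := by
  have hψc := ψ.2.1.continuous
  have hcont : ∀ ν : PosMeasure Ω, Continuous fun y => ψ.1 (G (ν, y)) := fun ν => by fun_prop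
  have hint : ∀ (ν : PosMeasure Ω) (m : Measure Ω) [IsFiniteMeasure m],
      Integrable (fun y => ψ.1 (G (ν, y))) m := fun ν m _ =>
    (hcont ν).integrable_of_hasCompactSupport (HasCompactSupport.of_compactSpace _)
  have hI : ∀ ν : PosMeasure Ω, ∫ z, ψ.1 z ∂(f ν).toMeas = ∫ y, ψ.1 (G (ν, y)) ∂ν.toMeas := by
    intro ν
    rw [(h ν).2, integral_map (h ν).1.aemeasurable hψc.measurable.aestronglyMeasurable]
  obtain ⟨U, -, hU, hUc⟩ := hψ
  have hgμ : Continuous fun y => G (μ, y) := by fun_prop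
  have hstay : ∀ᶠ ε in 𝓝 (0 : ℝ≥0), ∀ y ∈ μ.toMeas.support,
      ψ.1 (G (μ.addDirac ε x, y)) = ψ.1 (G (μ, y)) := by
    refine Measure.isClosed_support.isCompact.eventually_forall_of_forall_eventually fun y hy => ?_
    have hmem : G (μ, y) ∈ U := hU (by rw [(h μ).2]; exact map_mem_support hgμ hy)
    have hloc := hUc _ hmem
    have l1 : Tendsto (fun q : ℝ≥0 × Ω => G (μ.addDirac q.1 x, q.2)) (𝓝 (0, y)) (𝓝 (G (μ, y))) :=
      (hG.tendsto (μ, y)).comp (((μ.tendsto_addDirac x).comp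
        (continuous_fst.tendsto (0, y))).prodMk_nhds (continuous_snd.tendsto (0, y)))
    have l2 : Tendsto (fun q : ℝ≥0 × Ω => G (μ, q.2)) (𝓝 (0, y)) (𝓝 (G (μ, y))) :=
      (hgμ.tendsto y).comp (continuous_snd.tendsto (0, y))
    filter_upwards [l1.eventually hloc, l2.eventually hloc] with q h1 h2
    rw [h1, h2]
  have hlim : Tendsto (fun ε : ℝ≥0 => ψ.1 (G (μ.addDirac ε x, x))) (𝓝[>] 0) (𝓝 (ψ.1 (G (μ, x)))) :=
    (hψc.tendsto _).comp ((hG.tendsto (μ, x)).comp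
      (((μ.tendsto_addDirac x).mono_left nhdsWithin_le_nhds).prodMk_nhds tendsto_const_nhds))
  refine hlim.congr' ?_
  filter_upwards [nhdsWithin_le_nhds hstay, self_mem_nhdsWithin] with ε hε hε0
  have hε0' : (ε : ℝ) ≠ 0 := by exact_mod_cast (ne_of_gt hε0)
  have e1 : (μ.addDirac ε x).toMeas = μ.toMeas + ε • Measure.dirac x := rfl
  have e2 : ∫ y, ψ.1 (G (μ.addDirac ε x, y)) ∂μ.toMeas = ∫ y, ψ.1 (G (μ, y)) ∂μ.toMeas := by
    refine integral_congr_ae ?_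
    filter_upwards [Measure.support_mem_ae (μ := μ.toMeas)] with y hy using hε y hy
  rw [diffQuotient, hI, hI, e1, integral_add_measure (hint _ _) (hint _ _), e2,
    integral_smul_nnreal_measure, integral_dirac, add_sub_cancel_left, eq_div_iff hε0', mul_comm]
  rfl

theorem IsGivenBy.hasRegularPart (h : IsGivenBy f G) (hG : Continuous G)
    (p : PosMeasure Ω × Ω × TestFun d') : HasRegularPart f p (p.2.2.1 (G (p.1, p.2.1))) := by
  intro μk ψk hloc hμ hψ
  exact ⟨fun k => (ψk k).1 (G (μk k, p.2.1)), fun k => h.tendsto_diffQuotient hG _ (hloc k),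
    tendsto_apply_of_supDist hψ ((hG.tendsto (p.1, p.2.1)).comp
      ((PosMeasure.tendsto_of_W1 hμ).prodMk_nhds tendsto_const_nhds))⟩

end GivenBy

/-! ### Transfer of regularity between the in-context map and the derivative -/

section Transfer

variable {d d' : ℕ} {Ω : Set (E d)} {G : PosMeasure Ω × Ω → E d'}
  {D : PosMeasure Ω × Ω × TestFun d' → ℝ} {η : ℝ≥0} {S : Set ℝ≥0}

theorem edist_triplet_le (hDG : ∀ p ∈ tripletSpace Ω d' S η, D p = p.2.2.1 (G (p.1, p.2.1)))
    {p q : PosMeasure Ω × Ω × TestFun d'} (hp : p ∈ tripletSpace Ω d' S η)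
    (hq : q ∈ tripletSpace Ω d' S η) :
    edist (D p) (D q) ≤ η * edist (G (p.1, p.2.1)) (G (q.1, q.2.1)) + supDist p.2.2 q.2.2 := by
  rw [hDG p hp, hDG q hq]
  exact (edist_triangle _ (p.2.2.1 (G (q.1, q.2.1))) _).trans
    (add_le_add (hp.2 _ _) (edist_le_supDist _ _ _))

theorem tripletDist_same (p q : PosMeasure Ω × Ω) (ψ : TestFun d') :
    tripletDist (p.1, p.2, ψ) (q.1, q.2, ψ) = pairDist p q := by
  simp [tripletDist, pairDist, supDist_self]

/-- The values of `G` are recovered from `D` by testing with a separating function. -/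
theorem exists_edist_le (hη : 0 < η) :
    ∃ κ : ℝ≥0, 0 < κ ∧ ∀ (G : PosMeasure Ω × Ω → E d') (D : PosMeasure Ω × Ω × TestFun d' → ℝ)
      (S : Set ℝ≥0), (∀ p ∈ tripletSpace Ω d' S η, D p = p.2.2.1 (G (p.1, p.2.1))) →
      ∀ p ∈ pairSpace Ω S, ∀ q ∈ pairSpace Ω S, ∃ ψ : TestFun d',
        (p.1, p.2, ψ) ∈ tripletSpace Ω d' S η ∧ (q.1, q.2, ψ) ∈ tripletSpace Ω d' S η ∧
        κ * edist (G p) (G q) ≤ edist (D (p.1, p.2, ψ)) (D (q.1, q.2, ψ)) := by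
  obtain ⟨κ, hκ, h⟩ := exists_testFun_separating d' hη
  refine ⟨κ, hκ, fun G D S hDG p hp q hq => ?_⟩
  obtain ⟨ψ, h1, h2⟩ := h (G p) (G q)
  have hp' : (p.1, p.2, ψ) ∈ tripletSpace Ω d' S η := ⟨hp, h1⟩
  have hq' : (q.1, q.2, ψ) ∈ tripletSpace Ω d' S η := ⟨hq, h1⟩
  refine ⟨ψ, hp', hq', ?_⟩
  rw [hDG _ hp', hDG _ hq']
  exact h2

theorem uniformContinuousOnWrt_iff (hη : 0 < η)
    (hDG : ∀ p ∈ tripletSpace Ω d' S η, D p = p.2.2.1 (G (p.1, p.2.1))) :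
    UniformContinuousOnWrt pairDist edist G (pairSpace Ω S) ↔
      UniformContinuousOnWrt tripletDist edist D (tripletSpace Ω d' S η) := by
  constructor
  · intro h ε hε
    have hη' : (η : ℝ≥0∞) ≠ 0 := by exact_mod_cast hη.ne'
    obtain ⟨δ, hδ, H⟩ := h (ε / 2 / η)
      (ENNReal.div_pos (ENNReal.half_pos hε.ne').ne' ENNReal.coe_ne_top)
    refine ⟨min δ (ε / 2), lt_min hδ (ENNReal.half_pos hε.ne'), fun p hp q hq hpq => ?_⟩
    have h1 : pairDist (p.1, p.2.1) (q.1, q.2.1) < δ :=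
      (le_self_add.trans_lt hpq).trans_le (min_le_left _ _)
    have h2 : supDist p.2.2 q.2.2 < ε / 2 :=
      (le_add_self.trans_lt hpq).trans_le (min_le_right _ _)
    have h3 := H (p.1, p.2.1) hp.1 (q.1, q.2.1) hq.1 h1
    refine (edist_triplet_le hDG hp hq).trans_lt ?_
    have h4 : η * edist (G (p.1, p.2.1)) (G (q.1, q.2.1)) ≤ ε / 2 := by
      rw [mul_comm]
      exact (ENNReal.le_div_iff_mul_le (Or.inl hη') (Or.inl ENNReal.coe_ne_top)).1 h3.le
    by_cases htop : ε = ∞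
    · rw [htop]
      exact ENNReal.add_lt_top.2 ⟨(ENNReal.mul_lt_top ENNReal.coe_lt_top (edist_lt_top _ _)),
        h2.trans_le le_top⟩
    · calc _ < ε / 2 + ε / 2 := ENNReal.add_lt_add_of_le_of_lt
            (ENNReal.mul_lt_top ENNReal.coe_lt_top (edist_lt_top _ _)).ne h4 h2
        _ = ε := ENNReal.add_halves ε
  · intro h ε hε
    obtain ⟨κ, hκ, hsep⟩ := exists_edist_le (Ω := Ω) (d' := d') hη
    have hκ' : (κ : ℝ≥0∞) ≠ 0 := by exact_mod_cast hκ.ne'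
    obtain ⟨δ, hδ, H⟩ := h (κ * ε) (pos_iff_ne_zero.2 (mul_ne_zero hκ' hε.ne'))
    refine ⟨δ, hδ, fun p hp q hq hpq => ?_⟩
    obtain ⟨ψ, h1, h2, h3⟩ := hsep G D S hDG p hp q hq
    have h4 := h3.trans_lt (H _ h1 _ h2 (by rwa [tripletDist_same]))
    exact lt_of_mul_lt_mul_left' h4

theorem lipschitzOnWrt_iff (hη : 0 < η)
    (hDG : ∀ p ∈ tripletSpace Ω d' S η, D p = p.2.2.1 (G (p.1, p.2.1))) :
    LipschitzOnWrt pairDist edist G (pairSpace Ω S) ↔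
      LipschitzOnWrt tripletDist edist D (tripletSpace Ω d' S η) := by
  constructor
  · rintro ⟨C, hC⟩
    refine ⟨η * C + 1, fun p hp q hq => (edist_triplet_le hDG hp hq).trans ?_⟩
    have h1 := hC (p.1, p.2.1) hp.1 (q.1, q.2.1) hq.1
    calc η * edist (G (p.1, p.2.1)) (G (q.1, q.2.1)) + supDist p.2.2 q.2.2
        ≤ η * (C * pairDist (p.1, p.2.1) (q.1, q.2.1)) + supDist p.2.2 q.2.2 := by gcongr
      _ ≤ η * (C * tripletDist p q) + tripletDist p q := by
          gcongr
          · exact le_self_add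
          · exact le_add_self
      _ = ((η * C + 1 : ℝ≥0) : ℝ≥0∞) * tripletDist p q := by
          push_cast; ring
  · rintro ⟨C, hC⟩
    obtain ⟨κ, hκ, hsep⟩ := exists_edist_le (Ω := Ω) (d' := d') hη
    have hκ' : (κ : ℝ≥0∞) ≠ 0 := by exact_mod_cast hκ.ne'
    refine ⟨C / κ, fun p hp q hq => ?_⟩
    obtain ⟨ψ, h1, h2, h3⟩ := hsep G D S hDG p hp q hq
    have h4 := h3.trans (hC _ h1 _ h2)
    rw [tripletDist_same] at h4
    rw [ENNReal.coe_div hκ.ne', ENNReal.mul_div_right_comm.symm,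
      ENNReal.le_div_iff_mul_le (Or.inl hκ') (Or.inl ENNReal.coe_ne_top), mul_comm]
    exact h4

theorem continuous_of_uniformContinuousOnWrt [CompactSpace Ω]
    (h : ∀ δ ρ : ℝ≥0, 0 < δ → UniformContinuousOnWrt pairDist edist G (pairSpace Ω (Set.Icc δ ρ))) :
    Continuous G := by
  refine continuous_iff_continuousAt.2 fun p => tendsto_iff_edist_tendsto_0.2 ?_
  rw [ENNReal.tendsto_nhds_zero]
  intro ε hε
  have hm : 0 < p.1.mass := pos_iff_ne_zero.2 p.1.mass_ne_zero
  obtain ⟨δ, hδ, H⟩ := h (p.1.mass / 2) (p.1.mass + 1) (half_pos hm) ε hε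
  have hI : pairSpace Ω (Set.Icc (p.1.mass / 2) (p.1.mass + 1)) ∈ 𝓝 p :=
    (PosMeasure.continuous_mass.comp continuous_fst).continuousAt
      (Icc_mem_nhds (half_lt_self hm) (lt_add_one _))
  filter_upwards [(tendsto_pairDist_iff.2 (tendsto_id (x := 𝓝 p))).eventually (gt_mem_nhds hδ),
    hI] with q h1 h2
  exact (H q h2 p (mem_of_mem_nhds hI) h1).le

end Transfer

/-! ### Reconstruction of the in-context map -/

section Reconstruction

variable {d d' : ℕ} {Ω : Set (E d)} [CompactSpace Ω] {f : PosMeasure Ω → PosMeasure (E d')}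
  {D : PosMeasure Ω × Ω × TestFun d' → ℝ} {η : ℝ≥0}

/-- At an arbitrary pair `(μ, x)` the regular part of the derivative is the evaluation at a point of
`E d'`. The points for dissociated measures near `μ` with an atom at `x` form a Cauchy sequence,
because the continuity of `D` is uniform in the test function. -/
theorem exists_eval_eq (hfc : Continuous f) (hf : SupportPreserving f) (hη : 0 < η)
    (hD : IsRegularPart f η D)
    (hU : ∀ δ ρ : ℝ≥0, 0 < δ → UniformContinuousOnWrt tripletDist edist D
      (tripletSpace Ω d' (Set.Icc δ ρ) η)) :
    ∃ G : PosMeasure Ω × Ω → E d',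
      ∀ p ∈ tripletSpace Ω d' Set.univ η, D p = p.2.2.1 (G (p.1, p.2.1)) := by
  have key : ∀ q : PosMeasure Ω × Ω, ∃ y : E d', ∀ ψ : TestFun d', LipschitzWith η ψ.1 →
      D (q.1, q.2, ψ) = ψ.1 y := by
    rintro ⟨μ, x⟩
    obtain ⟨ν, hν, hdis⟩ := exists_seq_isDissociated μ x
    have hy : ∀ n, ∃ y : E d', ∀ ψ : TestFun d', LipschitzWith η ψ.1 →
        D (ν n, x, ψ) = ψ.1 y := by
      intro n
      obtain ⟨-, m, r, k, z, hz, i, hi⟩ := hdis n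
      obtain ⟨y, -, hyD⟩ := hz.exists_regularPart hfc hf
      refine ⟨y i, fun ψ hψ => hyD i ψ _ ?_⟩
      rw [hi]
      exact hD _ ⟨trivial, hψ⟩
    choose y hy using hy
    have hunif : ∀ ε : ℝ≥0∞, 0 < ε → ∀ᶠ n in atTop, ∀ ψ : TestFun d', LipschitzWith η ψ.1 →
        edist (ψ.1 (y n)) (D (μ, x, ψ)) < ε := by
      intro ε hε
      obtain ⟨δ, hδ, H⟩ := hU μ.mass μ.mass (pos_iff_ne_zero.2 μ.mass_ne_zero) ε hε
      filter_upwards [hν.eventually (gt_mem_nhds hδ)] with n hn ψ hψ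
      rw [← hy n ψ hψ]
      refine H _ ⟨?_, hψ⟩ _ ⟨?_, hψ⟩ ?_
      · simp [(hdis n).1]
      · simp
      · simpa [tripletDist, supDist_self] using hn
    obtain ⟨κ, hκ, hsep⟩ := exists_testFun_separating d' hη
    have hκ' : (κ : ℝ≥0∞) ≠ 0 := by exact_mod_cast hκ.ne'
    have hcauchy : CauchySeq y := by
      rw [EMetric.cauchySeq_iff]
      intro ε hε
      have hκε : 0 < κ * ε / 2 := ENNReal.half_pos (mul_ne_zero hκ' hε.ne')
      obtain ⟨N, hN⟩ := eventually_atTop.1 (hunif _ hκε)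
      refine ⟨N, fun a ha b hb => ?_⟩
      obtain ⟨ψ, hψ, hψs⟩ := hsep (y a) (y b)
      have h1 := hN a ha ψ hψ
      have h2 := hN b hb ψ hψ
      have h3 : κ * edist (y a) (y b) < κ * ε := by
        calc κ * edist (y a) (y b) ≤ edist (ψ.1 (y a)) (ψ.1 (y b)) := hψs
          _ ≤ edist (ψ.1 (y a)) (D (μ, x, ψ)) + edist (ψ.1 (y b)) (D (μ, x, ψ)) :=
            edist_triangle_right _ _ _
          _ < κ * ε / 2 + κ * ε / 2 := ENNReal.add_lt_add h1 h2
          _ = κ * ε := ENNReal.add_halves _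
      exact lt_of_mul_lt_mul_left' h3
    obtain ⟨y₀, hy₀⟩ := cauchySeq_tendsto_of_complete hcauchy
    refine ⟨y₀, fun ψ hψ => ?_⟩
    refine tendsto_nhds_unique ?_ ((ψ.2.1.continuous.tendsto y₀).comp hy₀)
    rw [tendsto_iff_edist_tendsto_0, ENNReal.tendsto_nhds_zero]
    intro ε hε
    filter_upwards [hunif ε hε] with n hn using (hn ψ hψ).le
  choose G hG using key
  exact ⟨G, fun p hp => hG (p.1, p.2.1) p.2.2 hp.2⟩

theorem tendsto_integral_comp {G : PosMeasure Ω × Ω → E d'} (hG : Continuous G)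
    {ν : ℕ → PosMeasure Ω} {μ : PosMeasure Ω} (hν : Tendsto ν atTop (𝓝 μ))
    (φ : BoundedContinuousFunction (E d') ℝ) :
    Tendsto (fun n => ∫ x, φ (G (ν n, x)) ∂(ν n).toMeas) atTop
      (𝓝 (∫ x, φ (G (μ, x)) ∂μ.toMeas)) := by
  let g : C(PosMeasure Ω, C(Ω, ℝ)) := ContinuousMap.curry ⟨fun p => φ (G p), by fun_prop⟩
  have hg : ∀ ν x, g ν x = φ (G (ν, x)) := fun _ _ => rfl
  have hint : ∀ (h : C(Ω, ℝ)) (ν : PosMeasure Ω), Integrable h ν.toMeas := fun h ν =>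
    h.continuous.integrable_of_hasCompactSupport (HasCompactSupport.of_compactSpace _)
  have h1 : Tendsto (fun n => ∫ x, g μ x ∂(ν n).toMeas) atTop (𝓝 (∫ x, g μ x ∂μ.toMeas)) :=
    PosMeasure.tendsto_integral hν (BoundedContinuousFunction.mkOfCompact (g μ))
  have h2 : Tendsto (fun n => ∫ x, (g (ν n) - g μ) x ∂(ν n).toMeas) atTop (𝓝 0) := by
    have h3 : Tendsto (fun n => ‖g (ν n) - g μ‖ * ((ν n).mass : ℝ)) atTop (𝓝 (0 * (μ.mass : ℝ))) :=
      (tendsto_iff_norm_sub_tendsto_zero.1 ((g.continuous.tendsto μ).comp hν)).mul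
        ((NNReal.continuous_coe.tendsto _).comp ((PosMeasure.continuous_mass.tendsto μ).comp hν))
    rw [zero_mul] at h3
    refine squeeze_zero_norm (fun n => ?_) h3
    refine (norm_integral_le_of_norm_le_const
      (Eventually.of_forall fun x => (g (ν n) - g μ).norm_coe_le_norm x)).trans_eq ?_
    rw [Measure.real, PosMeasure.toMeas_univ, ENNReal.coe_toReal]
  have h4 := h1.add h2
  rw [add_zero] at h4
  refine h4.congr fun n => ?_
  rw [← integral_add (hint _ _) (hint _ _)]
  refine integral_congr_ae (Eventually.of_forall fun x => ?_)
  simp [hg]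

/-- The identity `f = f_G` holds at dissociated measures, and both sides are continuous. -/
theorem isGivenBy_of_eval_eq (hfc : Continuous f) (hf : SupportPreserving f) (hη : 0 < η)
    (hD : IsRegularPart f η D) {G : PosMeasure Ω × Ω → E d'} (hG : Continuous G)
    (hDG : ∀ p ∈ tripletSpace Ω d' Set.univ η, D p = p.2.2.1 (G (p.1, p.2.1))) :
    IsGivenBy f G := by
  have hGm : ∀ μ, Measurable fun x => G (μ, x) := fun μ =>
    (by fun_prop : Continuous fun x => G (μ, x)).measurable
  intro μ
  refine ⟨hGm μ, ?_⟩
  obtain ⟨x₀⟩ := μ.nonempty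
  obtain ⟨ν, hν, hdis⟩ := exists_seq_isDissociated μ x₀
  have hνμ : Tendsto ν atTop (𝓝 μ) := PosMeasure.tendsto_of_W1 hν
  have hdisc : ∀ n, (f (ν n)).toMeas = (ν n).toMeas.map fun x => G (ν n, x) := by
    intro n
    obtain ⟨-, m, r, k, z, hz, -⟩ := hdis n
    obtain ⟨y, hy, hyD⟩ := hz.exists_regularPart hfc hf
    rw [hy, hz.toMeas_eq, Measure.map_finset_sum (hGm _).aemeasurable]
    refine Finset.sum_congr rfl fun j _ => ?_
    rw [Measure.map_smul, Measure.map_dirac' (hGm _)]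
    obtain ⟨κ, hκ, hsep⟩ := exists_testFun_separating d' hη
    obtain ⟨ψ, hψ, hψs⟩ := hsep (y j) (G (ν n, z j))
    have h1 := hyD j ψ _ (hD (ν n, z j, ψ) ⟨trivial, hψ⟩)
    rw [hDG (ν n, z j, ψ) ⟨trivial, hψ⟩] at h1
    have h2 : (κ : ℝ≥0∞) * edist (y j) (G (ν n, z j)) = 0 := by
      refine le_antisymm (hψs.trans ?_) zero_le
      rw [← h1, edist_self]
    have h3 := (mul_eq_zero.1 h2).resolve_left (by exact_mod_cast hκ.ne')
    rw [edist_eq_zero.1 h3]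
  refine ext_of_forall_integral_eq_of_IsFiniteMeasure fun φ => ?_
  rw [integral_map (hGm μ).aemeasurable φ.continuous.measurable.aestronglyMeasurable]
  refine tendsto_nhds_unique (PosMeasure.tendsto_integral ((hfc.tendsto μ).comp hνμ) φ) ?_
  refine (tendsto_integral_comp hG hνμ φ).congr fun n => ?_
  simp only [Function.comp]
  rw [hdisc, integral_map (hGm _).aemeasurable φ.continuous.measurable.aestronglyMeasurable]

end Reconstruction

theorem UniformContinuousOnWrt.mono {A B : Type*} {dA : A → A → ℝ≥0∞} {dB : B → B → ℝ≥0∞}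
    {g : A → B} {S T : Set A} (h : UniformContinuousOnWrt dA dB g T) (hST : S ⊆ T) :
    UniformContinuousOnWrt dA dB g S := by
  intro ε hε
  obtain ⟨δ, hδ, H⟩ := h ε hε
  exact ⟨δ, hδ, fun a ha a' ha' => H a (hST ha) a' (hST ha')⟩

end InContext

theorem theorem1 {d d' : ℕ} (Ω : Set (InContext.E d)) (hΩ : IsCompact Ω)
    (f : InContext.PosMeasure Ω → InContext.PosMeasure (InContext.E d'))
    (hf : InContext.ContinuousWrt InContext.W1 InContext.W1 f)
    (η : ℝ≥0) (hη : 0 < η) :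
    -- continuity of `G`, and uniform continuity for masses in every `[δ, ρ]` with `δ > 0`
    ((∃ G : InContext.PosMeasure Ω × Ω → InContext.E d',
        InContext.IsGivenBy f G ∧ InContext.ContinuousWrt InContext.pairDist edist G) ↔
      (InContext.SupportPreserving f ∧
        ∃ D : InContext.PosMeasure Ω × Ω × InContext.TestFun d' → ℝ,
          InContext.IsRegularPart f η D ∧
          ∀ δ ρ : ℝ≥0, 0 < δ → InContext.UniformContinuousOnWrt InContext.tripletDist edist D
            (InContext.tripletSpace Ω d' (Set.Icc δ ρ) η))) ∧
    -- uniform continuity for all masses in `(0, ρ]`, on both sides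
    ((∃ G : InContext.PosMeasure Ω × Ω → InContext.E d',
        InContext.IsGivenBy f G ∧
        ∀ ρ : ℝ≥0, InContext.UniformContinuousOnWrt InContext.pairDist edist G
          (InContext.pairSpace Ω (Set.Iic ρ))) ↔
      (InContext.SupportPreserving f ∧
        ∃ D : InContext.PosMeasure Ω × Ω × InContext.TestFun d' → ℝ,
          InContext.IsRegularPart f η D ∧
          ∀ ρ : ℝ≥0, InContext.UniformContinuousOnWrt InContext.tripletDist edist D
            (InContext.tripletSpace Ω d' (Set.Iic ρ) η))) ∧
    -- Lipschitz continuity, for masses in `(0, ρ]` and for all masses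
    (∀ (G : InContext.PosMeasure Ω × Ω → InContext.E d')
        (D : InContext.PosMeasure Ω × Ω × InContext.TestFun d' → ℝ),
      InContext.IsGivenBy f G → InContext.ContinuousWrt InContext.pairDist edist G →
      InContext.IsRegularPart f η D →
      (∀ ρ : ℝ≥0,
        InContext.LipschitzOnWrt InContext.pairDist edist G
            (InContext.pairSpace Ω (Set.Iic ρ)) ↔
          InContext.LipschitzOnWrt InContext.tripletDist edist D
            (InContext.tripletSpace Ω d' (Set.Iic ρ) η)) ∧
      (InContext.LipschitzOnWrt InContext.pairDist edist G
          (InContext.pairSpace Ω Set.univ) ↔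
        InContext.LipschitzOnWrt InContext.tripletDist edist D
          (InContext.tripletSpace Ω d' Set.univ η))) := by
  have hc : CompactSpace Ω := isCompact_iff_compactSpace.1 hΩ
  have hfc := InContext.continuous_of_continuousWrt_W1 hf
  refine ⟨⟨?_, ?_⟩, ⟨?_, ?_⟩, ?_⟩
  · rintro ⟨G, hG, hGc⟩
    rw [InContext.continuousWrt_pairDist_iff] at hGc
    exact ⟨hG.supportPreserving, fun p => p.2.2.1 (G (p.1, p.2.1)),
      fun p _ => hG.hasRegularPart hGc p, fun δ ρ hδ =>
        (InContext.uniformContinuousOnWrt_iff hη fun _ _ => rfl).1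
          (InContext.uniformContinuousOnWrt_of_continuous hGc hδ)⟩
  · rintro ⟨hsp, D, hD, hU⟩
    obtain ⟨G, hDG⟩ := InContext.exists_eval_eq hfc hsp hη hD hU
    have hGc : Continuous G := InContext.continuous_of_uniformContinuousOnWrt fun δ ρ hδ =>
      (InContext.uniformContinuousOnWrt_iff hη fun p hp => hDG p ⟨trivial, hp.2⟩).2 (hU δ ρ hδ)
    exact ⟨G, InContext.isGivenBy_of_eval_eq hfc hsp hη hD hGc hDG,
      InContext.continuousWrt_pairDist_iff.2 hGc⟩
  · rintro ⟨G, hG, hGu⟩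
    have hGc : Continuous G := InContext.continuous_of_uniformContinuousOnWrt fun δ ρ _ =>
      (hGu ρ).mono fun p hp => hp.2
    exact ⟨hG.supportPreserving, fun p => p.2.2.1 (G (p.1, p.2.1)),
      fun p _ => hG.hasRegularPart hGc p, fun ρ =>
        (InContext.uniformContinuousOnWrt_iff hη fun _ _ => rfl).1 (hGu ρ)⟩
  · rintro ⟨hsp, D, hD, hU⟩
    obtain ⟨G, hDG⟩ := InContext.exists_eval_eq hfc hsp hη hD fun δ ρ _ =>
      (hU ρ).mono fun p hp => ⟨hp.1.2, hp.2⟩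
    have hGu : ∀ ρ : ℝ≥0, InContext.UniformContinuousOnWrt InContext.pairDist edist G
        (InContext.pairSpace Ω (Set.Iic ρ)) := fun ρ =>
      (InContext.uniformContinuousOnWrt_iff hη fun p hp => hDG p ⟨trivial, hp.2⟩).2 (hU ρ)
    have hGc : Continuous G := InContext.continuous_of_uniformContinuousOnWrt fun δ ρ _ =>
      (hGu ρ).mono fun p hp => hp.2
    exact ⟨G, InContext.isGivenBy_of_eval_eq hfc hsp hη hD hGc hDG, hGu⟩
  · intro G D hG hGc hD
    rw [InContext.continuousWrt_pairDist_iff] at hGc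
    have hDG : ∀ p ∈ InContext.tripletSpace Ω d' Set.univ η, D p = p.2.2.1 (G (p.1, p.2.1)) :=
      fun p hp => (hD p hp).unique hG.supportPreserving (hG.hasRegularPart hGc p)
    exact ⟨fun ρ => InContext.lipschitzOnWrt_iff hη fun p hp => hDG p ⟨trivial, hp.2⟩,
      InContext.lipschitzOnWrt_iff hη hDG⟩
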